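/- Let $U\subset\mathbb R^2$ be an open neighborhood of the origin, let $S:U\to\mathbb R$ be real analytic, and let $\phi:\mathbb R^2\to\mathbb C$ be a $C^\infty$ function with compact support such that the convex hull $\mathrm{Conv}(\operatorname{supp}\phi)$ of its closed support is contained in $U$. Assume that $$|\partial_x\partial_y(\partial_x-\partial_y)S(x,y)|\ge 1\qquad\text{for all }(x,y)\in\mathrm{Conv}(\operatorname{supp}\phi).$$ For $\lambda\in\mathbb R$ and $f,g,h:\mathbb R\to\mathbb C$ put $$\Lambda(f,g,h)=\iint_{\mathbb R^2} e^{i\lambda S(x,y)}f(x)\,g(y)\,h(x+y)\,\phi(x,y)\,dx\,dy .$$ Then for all real numbers $p,q,r\in[2,4)$ with $\frac1p+\frac1q+\frac1r=\frac54$ there is a constant $C>0$, depending only on $S$, $\phi$ and $p,q,r$, such that for all real $\lambda\neq0$ and all $f\in L^p(\mathbb R)$, $g\in L^q(\mathbb R)$, $h\in L^r(\mathbb R)$ the integral defining $\Lambda(f,g,h)$ converges absolutely and $$|\Lambda(f,g,h)|\le C\,|\lambda|^{-1/4}\,\|f\|_{L^p}\|g\|_{L^q}\|h\|_{L^r}.$$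 -/

import Mathlib

open MeasureTheory
open scoped ContDiff

noncomputable section

namespace TrilinearForm

/-- The partial derivative in the first variable. -/
def partialX (F : ℝ × ℝ → ℝ) : ℝ × ℝ → ℝ :=
  fun z => deriv (fun t : ℝ => F (t, z.2)) z.1

/-- The partial derivative in the second variable. -/
def partialY (F : ℝ × ℝ → ℝ) : ℝ × ℝ → ℝ :=
  fun z => deriv (fun t : ℝ => F (z.1, t)) z.2

/-- The differential operator `D = ∂x ∂y (∂x - ∂y)`. -/
def opD (S : ℝ × ℝ → ℝ) : ℝ × ℝ → ℝ :=
  partialX (partialY (fun z => partialX S z - partialY S z))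

/-- The integrand `e^{iλS(x,y)} f(x) g(y) h(x+y) φ(x,y)`. -/
def integrand (lam : ℝ) (S : ℝ × ℝ → ℝ) (φ : ℝ × ℝ → ℂ) (f g h : ℝ → ℂ) : ℝ × ℝ → ℂ :=
  fun z => Complex.exp (Complex.I * ((lam * S z : ℝ) : ℂ)) *
    f z.1 * g z.2 * h (z.1 + z.2) * φ z

/-- The trilinear form `Λ(f,g,h)`, an integral over the plane with respect to Lebesgue measure. -/
def form (lam : ℝ) (S : ℝ × ℝ → ℝ) (φ : ℝ × ℝ → ℂ) (f g h : ℝ → ℂ) : ℂ :=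
  ∫ z : ℝ × ℝ, integrand lam S φ f g h z

/-- The `L^p(ℝ)` norm for a real exponent `p`, used only for functions in `L^p`. -/
def normLp (p : ℝ) (f : ℝ → ℂ) : ℝ :=
  (eLpNorm f (ENNReal.ofReal p) volume).toReal

/-- The set of exponents `(p,q,r)` with `p, q, r ∈ [2,4)` and `1/p + 1/q + 1/r = 5/4`. -/
def exponents : Set (ℝ × ℝ × ℝ) :=
  {e | e.1 ∈ Set.Ico 2 4 ∧ e.2.1 ∈ Set.Ico 2 4 ∧ e.2.2 ∈ Set.Ico 2 4 ∧
    1 / e.1 + 1 / e.2.1 + 1 / e.2.2 = 5 / 4}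

end TrilinearForm

end

/-! The heart is the edge r = 2 of the exponent triangle, with p, q in (2,4) and 1/p + 1/q = 3/4
(`trilinearBound_of_third_eq_two`). In the coordinate t = x + y, Λ is ∫ h(t) T(t) dt. Cauchy–Schwarz
in t and the expansion of |T|² with second variable x + s (`enorm_integral_mul_integral_sq_le`) give
|Λ|² ≤ ‖h‖₂² ∫ |I(s)| ds. Here I(s) is a bilinear form in F_s(x) = f(x) conj f(x+s) and G_s(y) =
g(y) conj g(y-s), with phase λ(S(x,y) - S(x+s,y-s)).

This phase has mixed derivative of size |λs|, so Hörmander's argument gives |I(s)| ≲ |λs|^{-1/2}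
‖F_s‖₂ ‖G_s‖₂. That is a second TT*, whose kernel decays by nonstationary phase. The derivative of
its phase is λ times a second difference of ∂x S over a parallelogram, hence λs(y'-y) times a value
of DS at an interior point. The corners lie in the support, so that point lies in the convex hull,
where |DS| ≥ 1.

Now write |s|^{-1} = |s|^{-a}|s|^{-b} with a = 2 - 4/p and b = 2 - 4/q; the relation 1/p + 1/q = 3/4
says exactly that a + b = 1. Cauchy–Schwarz in s and the diagonal Hardy–Littlewood–Sobolev
inequality for |f|² in L^{p/2} and |g|² in L^{q/2} finish the edge.

A linear map permutes x, y, x + y up to sign and preserves |D|, so the other two edges follow.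
Interior exponents come from the edges q = 2 and r = 2 by complex interpolation in (g,h), with f
fixed. Density of simple functions then gives all of L^p × L^q × L^r. A cutoff first replaces S by a
compactly supported smooth phase agreeing with it near the hull. -/

namespace TrilinearForm

/-! ### Directional derivatives and second differences. -/

/-- The derivative of `F` in the direction `v`. -/
noncomputable def dirDeriv {E : Type*} [NormedAddCommGroup E] [NormedSpace ℝ E]
    (v : ℝ × ℝ) (F : ℝ × ℝ → E) : ℝ × ℝ → E :=
  fun z => fderiv ℝ F z v

theorem contDiff_dirDeriv {E : Type*} [NormedAddCommGroup E] [NormedSpace ℝ E]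
    {F : ℝ × ℝ → E} (hF : ContDiff ℝ ∞ F) (v : ℝ × ℝ) :
    ContDiff ℝ ∞ (dirDeriv v F) := by
  have h : ContDiff ℝ ∞ (fderiv ℝ F) := hF.fderiv_right (by simp)
  exact h.clm_apply contDiff_const

theorem hasCompactSupport_dirDeriv {E : Type*} [NormedAddCommGroup E] [NormedSpace ℝ E]
    {F : ℝ × ℝ → E} (hF : HasCompactSupport F) (v : ℝ × ℝ) :
    HasCompactSupport (dirDeriv v F) :=
  hF.fderiv_apply (𝕜 := ℝ) v

theorem dirDeriv_comm {F : ℝ × ℝ → ℝ} (hF : ContDiff ℝ ∞ F) (u v : ℝ × ℝ) :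
    dirDeriv u (dirDeriv v F) = dirDeriv v (dirDeriv u F) := by
  have key : ∀ u v z, dirDeriv u (dirDeriv v F) z = fderiv ℝ (fderiv ℝ F) z u v := by
    intro u v z
    have h : ContDiff ℝ ∞ (fderiv ℝ F) := hF.fderiv_right (by simp)
    have h1 : DifferentiableAt ℝ (fderiv ℝ F) z := (h.differentiable (by simp)) z
    unfold dirDeriv
    rw [fderiv_clm_apply h1 (differentiableAt_const v)]
    simp
  funext z
  rw [key, key]
  have hs : IsSymmSndFDerivAt ℝ F z :=
    hF.contDiffAt.isSymmSndFDerivAt (by simp; exact WithTop.coe_le_coe.2 le_top)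
  exact hs u v

theorem dirDeriv_comp_linear {F : ℝ × ℝ → ℝ} (hF : ContDiff ℝ ∞ F) (L : ℝ × ℝ →L[ℝ] ℝ × ℝ)
    (v : ℝ × ℝ) : dirDeriv v (F ∘ L) = dirDeriv (L v) F ∘ L := by
  funext z
  have h := ((hF.differentiable (by simp)) (L z)).hasFDerivAt.comp z L.hasFDerivAt
  simp [dirDeriv, h.fderiv]

theorem dirDeriv_neg_dir (F : ℝ × ℝ → ℝ) (v : ℝ × ℝ) :
    dirDeriv (-v) F = fun z => - dirDeriv v F z := by
  funext z; simp [dirDeriv]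

theorem dirDeriv_neg_fun (F : ℝ × ℝ → ℝ) (v : ℝ × ℝ) :
    dirDeriv v (fun z => - F z) = fun z => - dirDeriv v F z := by
  funext z
  simp [dirDeriv, fderiv_fun_neg]

theorem dirDeriv_smul_dir (F : ℝ × ℝ → ℝ) (c : ℝ) (v : ℝ × ℝ) :
    dirDeriv (c • v) F = fun z => c * dirDeriv v F z := by
  funext z; simp [dirDeriv]

theorem dirDeriv_const_mul {F : ℝ × ℝ → ℝ} (hF : ContDiff ℝ ∞ F) (c : ℝ) (v : ℝ × ℝ) :
    dirDeriv v (fun z => c * F z) = fun z => c * dirDeriv v F z := by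
  funext z
  have := (hF.differentiable (by simp)) z
  simp [dirDeriv, fderiv_const_mul this]

theorem hasDerivAt_line {F : ℝ × ℝ → ℝ} (hF : ContDiff ℝ ∞ F) (z v : ℝ × ℝ) (t : ℝ) :
    HasDerivAt (fun t : ℝ => F (z + t • v)) (dirDeriv v F (z + t • v)) t := by
  have h1 : HasDerivAt (fun t : ℝ => z + t • v) v t := by
    simpa using ((hasDerivAt_id t).smul_const v).const_add z
  exact ((hF.differentiable (by simp)) _).hasFDerivAt.comp_hasDerivAt t h1

theorem hasDerivAt_fst {E : Type*} [NormedAddCommGroup E] [NormedSpace ℝ E]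
    {F : ℝ × ℝ → E} (hF : ContDiff ℝ ∞ F) (x y : ℝ) :
    HasDerivAt (fun t : ℝ => F (t, y)) (dirDeriv (1, 0) F (x, y)) x :=
  HasFDerivAt.comp_hasDerivAt (f := fun t : ℝ => (t, y)) x
    ((hF.differentiable (by simp)) _).hasFDerivAt ((hasDerivAt_id x).prodMk (hasDerivAt_const x y))

theorem hasDerivAt_snd {F : ℝ × ℝ → ℝ} (hF : ContDiff ℝ ∞ F) (x y : ℝ) :
    HasDerivAt (fun t : ℝ => F (x, t)) (dirDeriv (0, 1) F (x, y)) y :=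
  HasFDerivAt.comp_hasDerivAt (f := fun t : ℝ => (x, t)) y
    ((hF.differentiable (by simp)) _).hasFDerivAt ((hasDerivAt_const y x).prodMk (hasDerivAt_id y))

theorem partialX_eq {F : ℝ × ℝ → ℝ} (hF : ContDiff ℝ ∞ F) : partialX F = dirDeriv (1, 0) F :=
  funext fun z => (hasDerivAt_fst hF z.1 z.2).deriv

theorem partialY_eq {F : ℝ × ℝ → ℝ} (hF : ContDiff ℝ ∞ F) : partialY F = dirDeriv (0, 1) F :=
  funext fun z => (hasDerivAt_snd hF z.1 z.2).deriv

theorem opD_eq {F : ℝ × ℝ → ℝ} (hF : ContDiff ℝ ∞ F) :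
    opD F = dirDeriv (1, 0) (dirDeriv (0, 1) (dirDeriv (1, -1) F)) := by
  have h : (fun z => partialX F z - partialY F z) = dirDeriv (1, -1) F := by
    funext z
    rw [partialX_eq hF, partialY_eq hF]
    simp only [dirDeriv]
    rw [← map_sub]
    simp
  have h1 := contDiff_dirDeriv hF (1, -1)
  unfold opD
  rw [h, partialY_eq h1, partialX_eq (contDiff_dirDeriv h1 _)]

theorem exists_slope_eq_dirDeriv {F : ℝ × ℝ → ℝ} (hF : ContDiff ℝ ∞ F) (z v : ℝ × ℝ) :
    ∃ t ∈ Set.Ioo (0 : ℝ) 1, F (z + v) - F z = dirDeriv v F (z + t • v) := by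
  obtain ⟨t, ht, h⟩ := exists_hasDerivAt_eq_slope (fun t : ℝ => F (z + t • v))
    (fun t => dirDeriv v F (z + t • v)) one_pos
    (fun t _ => (hasDerivAt_line hF z v t).continuousAt.continuousWithinAt)
    (fun t _ => hasDerivAt_line hF z v t)
  exact ⟨t, ht, by simpa using h.symm⟩

/-- The mean value theorem for second differences over a parallelogram. -/
theorem exists_second_difference {F : ℝ × ℝ → ℝ} (hF : ContDiff ℝ ∞ F) (z u v : ℝ × ℝ) :
    ∃ a ∈ Set.Ioo (0 : ℝ) 1, ∃ b ∈ Set.Ioo (0 : ℝ) 1,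
      F (z + u + v) - F (z + v) - F (z + u) + F z =
        dirDeriv u (dirDeriv v F) (z + a • u + b • v) := by
  have hG : ContDiff ℝ ∞ (fun w => F (w + u) - F w) :=
    (hF.comp (contDiff_id.add contDiff_const)).sub hF
  -- The mean value theorem is used twice: along `v` for the difference `F (w + u) - F w`, then
  -- along `u` for the derivative so obtained.
  obtain ⟨b, hb, h⟩ := exists_slope_eq_dirDeriv hG z v
  have hd : dirDeriv v (fun w => F (w + u) - F w) (z + b • v) =
      dirDeriv v F (z + b • v + u) - dirDeriv v F (z + b • v) := by
    have hd := hF.differentiable (by simp)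
    simp only [dirDeriv]
    have hc : DifferentiableAt ℝ (fun w => F (w + u)) (z + b • v) :=
      (hd.comp (differentiable_id.add_const u)) _
    rw [fderiv_fun_sub hc (hd _),
      fderiv_comp_add_right]
    simp
  obtain ⟨a, ha, h2⟩ := exists_slope_eq_dirDeriv (contDiff_dirDeriv hF v) (z + b • v) u
  refine ⟨a, ha, b, hb, ?_⟩
  rw [hd, h2] at h
  rw [show z + a • u + b • v = z + b • v + a • u by abel, ← h,
    show z + v + u = z + u + v by abel]
  ring

theorem parallelogram_mem {K : Set (ℝ × ℝ)} (hK : Convex ℝ K) {z u v : ℝ × ℝ} (h0 : z ∈ K)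
    (hu : z + u ∈ K) (hv : z + v ∈ K) (huv : z + u + v ∈ K) {a b : ℝ}
    (ha : a ∈ Set.Ioo (0 : ℝ) 1) (hb : b ∈ Set.Ioo (0 : ℝ) 1) :
    z + a • u + b • v ∈ K := by
  have h1 : z + b • v ∈ K := hK.add_smul_mem h0 hv ⟨hb.1.le, hb.2.le⟩
  have h2 : z + u + b • v ∈ K := hK.add_smul_mem hu huv ⟨hb.1.le, hb.2.le⟩
  have h3 := hK.add_smul_mem (y := u) h1
    (by rwa [show z + b • v + u = z + u + b • v by abel]) (t := a) ⟨ha.1.le, ha.2.le⟩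
  rwa [show z + a • u + b • v = z + b • v + a • u by abel]

/-! ### Nonstationary phase in one variable. -/

/-- Zeros of `p` off the closed support of `a` are harmless: the quotient vanishes identically near
such points, division by zero being zero. -/
theorem contDiff_div_of_ne_zero {a : ℝ → ℂ} {p : ℝ → ℝ} (ha : ContDiff ℝ ∞ a)
    (hp : ContDiff ℝ ∞ p) (h : ∀ x ∈ tsupport a, p x ≠ 0) :
    ContDiff ℝ ∞ (fun x => a x / (p x : ℂ)) := by
  rw [contDiff_iff_contDiffAt]
  intro x
  by_cases hx : x ∈ tsupport a
  · have hp' : ContDiffAt ℝ ∞ (fun x => (p x : ℂ)) x :=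
      (Complex.ofRealCLM.contDiff.comp hp).contDiffAt
    simp only [div_eq_mul_inv]
    exact ha.contDiffAt.mul (hp'.inv (by exact_mod_cast h x hx))
  · have h0 : (fun x => a x / (p x : ℂ)) =ᶠ[nhds x] fun _ => 0 := by
      filter_upwards [notMem_tsupport_iff_eventuallyEq.1 hx] with t ht
      simp [ht]
    exact contDiffAt_const.congr_of_eventuallyEq h0

theorem tsupport_div_subset (a : ℝ → ℂ) (p : ℝ → ℝ) :
    tsupport (fun x => a x / (p x : ℂ)) ⊆ tsupport a :=
  closure_mono fun x hx => by
    simp only [Function.mem_support, ne_eq] at hx ⊢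
    exact fun h => hx (by simp [h])

/-- One integration by parts in an oscillatory integral without stationary points. -/
theorem integral_exp_mul_eq {a : ℝ → ℂ} {P : ℝ → ℝ} (ha : ContDiff ℝ ∞ a)
    (hac : HasCompactSupport a) (hP : ContDiff ℝ ∞ P) (h : ∀ x ∈ tsupport a, deriv P x ≠ 0) :
    ∫ x, Complex.exp (Complex.I * (P x : ℂ)) * a x =
      Complex.I * ∫ x, Complex.exp (Complex.I * (P x : ℂ)) *
        deriv (fun t => a t / ((deriv P t : ℝ) : ℂ)) x := by
  have hP' : ContDiff ℝ ∞ (deriv P) := (contDiff_infty_iff_deriv.1 hP).2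
  set v : ℝ → ℂ := fun t => a t / ((deriv P t : ℝ) : ℂ) with hv
  have hvC : ContDiff ℝ ∞ v := contDiff_div_of_ne_zero ha hP' h
  have hvc : HasCompactSupport v := hac.of_isClosed_subset (isClosed_tsupport _)
    (tsupport_div_subset a (deriv P))
  have hv' : ContDiff ℝ ∞ (deriv v) := (contDiff_infty_iff_deriv.1 hvC).2
  set u : ℝ → ℂ := fun x => Complex.exp (Complex.I * (P x : ℂ)) with hu
  have hPd : ∀ x, HasDerivAt P (deriv P x) x := fun x =>
    ((hP.differentiable (by simp)) x).hasDerivAt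
  have hud : ∀ x, HasDerivAt u (u x * (Complex.I * ((deriv P x : ℝ) : ℂ))) x := fun x =>
    (((hPd x).ofReal_comp).const_mul Complex.I).cexp
  have huc : Continuous u := continuous_iff_continuousAt.2 fun x => (hud x).continuousAt
  have hP'c : Continuous fun x => ((deriv P x : ℝ) : ℂ) :=
    Complex.continuous_ofReal.comp hP'.continuous
  have i1 : Integrable (u * deriv v) :=
    (huc.mul hv'.continuous).integrable_of_hasCompactSupport (hvc.deriv.mul_left)
  have i2 : Integrable ((fun x => u x * (Complex.I * ((deriv P x : ℝ) : ℂ))) * v) :=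
    ((huc.mul (continuous_const.mul hP'c)).mul hvC.continuous).integrable_of_hasCompactSupport
      hvc.mul_left
  have i3 : Integrable (u * v) :=
    (huc.mul hvC.continuous).integrable_of_hasCompactSupport hvc.mul_left
  have key := integral_mul_deriv_eq_deriv_mul_of_integrable (u := u) (v := v)
    (fun x _ => hud x) (fun x _ => ((hvC.differentiable (by simp)) x).hasDerivAt) i1 i2 i3
  rw [key, ← integral_neg, ← integral_const_mul]
  congr 1
  funext x
  by_cases hx : x ∈ tsupport a
  · have hne : ((deriv P x : ℝ) : ℂ) ≠ 0 := by exact_mod_cast h x hx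
    simp only [hv]
    field_simp
    linear_combination (u x * a x) * Complex.I_sq
  · simp [hv, image_eq_zero_of_notMem_tsupport hx]

theorem hasDerivAt_div {b : ℝ → ℂ} {p : ℝ → ℝ} {b' : ℂ} {p' x : ℝ} (hb : HasDerivAt b b' x)
    (hp : HasDerivAt p p' x) (h : p x ≠ 0) :
    HasDerivAt (fun t => b t / (p t : ℂ)) (b' / (p x : ℂ) - b x * p' / (p x : ℂ) ^ 2) x := by
  have hne : (p x : ℂ) ≠ 0 := by exact_mod_cast h
  have := hb.div hp.ofReal_comp hne
  refine this.congr_deriv ?_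
  field_simp

/-- This is the amplitude left by two integrations by parts. If P'' and P''' are O(m) where |P'| ≥
m, every term is O(m⁻²). -/
theorem deriv_deriv_div {a : ℝ → ℂ} {P : ℝ → ℝ} (ha : ContDiff ℝ ∞ a) (hP : ContDiff ℝ ∞ P)
    {x : ℝ} (h : deriv P x ≠ 0) :
    deriv (fun t => deriv (fun t => a t / ((deriv P t : ℝ) : ℂ)) t / ((deriv P t : ℝ) : ℂ)) x =
      deriv (deriv a) x / ((deriv P x : ℝ) : ℂ) ^ 2
        - 3 * deriv a x * ((deriv (deriv P) x : ℝ) : ℂ) / ((deriv P x : ℝ) : ℂ) ^ 3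
        - a x * ((deriv (deriv (deriv P)) x : ℝ) : ℂ) / ((deriv P x : ℝ) : ℂ) ^ 3
        + 3 * a x * ((deriv (deriv P) x : ℝ) : ℂ) ^ 2 / ((deriv P x : ℝ) : ℂ) ^ 4 := by
  have hP1 : ContDiff ℝ ∞ (deriv P) := (contDiff_infty_iff_deriv.1 hP).2
  have hP2 : ContDiff ℝ ∞ (deriv (deriv P)) := (contDiff_infty_iff_deriv.1 hP1).2
  have ha1 : ContDiff ℝ ∞ (deriv a) := (contDiff_infty_iff_deriv.1 ha).2
  have dP1 : ∀ t, HasDerivAt (deriv P) (deriv (deriv P) t) t := fun t =>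
    ((hP1.differentiable (by simp)) t).hasDerivAt
  have dP2 : ∀ t, HasDerivAt (deriv (deriv P)) (deriv (deriv (deriv P)) t) t := fun t =>
    ((hP2.differentiable (by simp)) t).hasDerivAt
  have da : ∀ t, HasDerivAt a (deriv a t) t := fun t =>
    ((ha.differentiable (by simp)) t).hasDerivAt
  have da1 : ∀ t, HasDerivAt (deriv a) (deriv (deriv a) t) t := fun t =>
    ((ha1.differentiable (by simp)) t).hasDerivAt
  have hev : ∀ᶠ t in nhds x, deriv P t ≠ 0 :=
    hP1.continuous.continuousAt.eventually_ne h
  have hE : (fun t => deriv (fun t => a t / ((deriv P t : ℝ) : ℂ)) t / ((deriv P t : ℝ) : ℂ)) =ᶠ[nhds x]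
      fun t => (deriv a t / ((deriv P t : ℝ) : ℂ) -
        (a t * ((deriv (deriv P) t : ℝ) : ℂ)) / ((deriv P t ^ 2 : ℝ) : ℂ)) / ((deriv P t : ℝ) : ℂ) := by
    filter_upwards [hev] with t ht
    rw [(hasDerivAt_div (da t) (dP1 t) ht).deriv]
    push_cast
    rfl
  have hne : ((deriv P x : ℝ) : ℂ) ≠ 0 := by exact_mod_cast h
  have h2 := hasDerivAt_div ((hasDerivAt_div (da1 x) (dP1 x) h).sub
    (hasDerivAt_div ((da x).mul (dP2 x).ofReal_comp) ((dP1 x).pow 2)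
      (by simpa using pow_ne_zero 2 h))) (dP1 x) h
  refine (hE.deriv_eq.trans h2.deriv).trans ?_
  simp only [Pi.mul_apply, Pi.sub_apply, Pi.pow_apply]
  push_cast
  field_simp
  ring

/-- The principle of nonstationary phase with quadratic decay. -/
theorem norm_integral_exp_mul_le {a : ℝ → ℂ} {P : ℝ → ℝ} {m M A R : ℝ} (ha : ContDiff ℝ ∞ a)
    (hP : ContDiff ℝ ∞ P) (haR : tsupport a ⊆ Set.Icc (-R) R) (hR : 0 ≤ R)
    (hm : 0 < m) (hM : 0 ≤ M) (hA : 0 ≤ A) (h1 : ∀ x ∈ tsupport a, m ≤ |deriv P x|)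
    (h2 : ∀ x, |deriv (deriv P) x| ≤ M * m) (h3 : ∀ x, |deriv (deriv (deriv P)) x| ≤ M * m)
    (a0 : ∀ x, ‖a x‖ ≤ A) (a1 : ∀ x, ‖deriv a x‖ ≤ A) (a2 : ∀ x, ‖deriv (deriv a) x‖ ≤ A) :
    ‖∫ x, Complex.exp (Complex.I * (P x : ℂ)) * a x‖ ≤
      A * (1 + 4 * M + 3 * M ^ 2) * (2 * R) / m ^ 2 := by
  have hac : HasCompactSupport a := isCompact_Icc.of_isClosed_subset (isClosed_tsupport _) haR
  have hP' : ContDiff ℝ ∞ (deriv P) := (contDiff_infty_iff_deriv.1 hP).2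
  have hne : ∀ x ∈ tsupport a, deriv P x ≠ 0 := fun x hx h0 => by
    have := h1 x hx
    rw [h0, abs_zero] at this
    linarith
  set b : ℝ → ℂ := deriv (fun t => a t / ((deriv P t : ℝ) : ℂ)) with hb
  have hvC : ContDiff ℝ ∞ (fun t => a t / ((deriv P t : ℝ) : ℂ)) := contDiff_div_of_ne_zero ha hP' hne
  have hbC : ContDiff ℝ ∞ b := (contDiff_infty_iff_deriv.1 hvC).2
  have hbs : tsupport b ⊆ tsupport a :=
    (tsupport_deriv_subset).trans (tsupport_div_subset a (deriv P))
  have hbc : HasCompactSupport b := hac.of_isClosed_subset (isClosed_tsupport _) hbs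
  set c : ℝ → ℂ := deriv (fun t => b t / ((deriv P t : ℝ) : ℂ)) with hc
  have hcs : tsupport c ⊆ tsupport a :=
    ((tsupport_deriv_subset).trans (tsupport_div_subset b (deriv P))).trans hbs
  have e1 := integral_exp_mul_eq ha hac hP hne
  have e2 := integral_exp_mul_eq hbC hbc hP (fun x hx => hne x (hbs hx))
  rw [← hb] at e1
  rw [← hc] at e2
  rw [e1, e2]
  have hbound : ∀ x, ‖c x‖ ≤ A * (1 + 4 * M + 3 * M ^ 2) / m ^ 2 := by
    intro x
    by_cases hx : x ∈ tsupport a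
    swap
    · rw [image_eq_zero_of_notMem_tsupport (fun h => hx (hcs h)), norm_zero]
      positivity
    rw [hc, hb, deriv_deriv_div ha hP (hne x hx)]
    have hp := h1 x hx
    have hp0 : 0 < |deriv P x| := hm.trans_le hp
    have t1 : ‖deriv (deriv a) x / ((deriv P x : ℝ) : ℂ) ^ 2‖ ≤ A / m ^ 2 := by
      rw [norm_div, norm_pow, Complex.norm_real, Real.norm_eq_abs]
      gcongr
      exact a2 x
    have t2 : ‖3 * deriv a x * ((deriv (deriv P) x : ℝ) : ℂ) / ((deriv P x : ℝ) : ℂ) ^ 3‖ ≤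
        3 * A * (M * m) / m ^ 3 := by
      rw [norm_div, norm_mul, norm_mul, norm_pow, Complex.norm_real, Complex.norm_real,
        Real.norm_eq_abs, Real.norm_eq_abs, Complex.norm_ofNat]
      gcongr
      exacts [a1 x, h2 x]
    have t3 : ‖a x * ((deriv (deriv (deriv P)) x : ℝ) : ℂ) / ((deriv P x : ℝ) : ℂ) ^ 3‖ ≤
        A * (M * m) / m ^ 3 := by
      rw [norm_div, norm_mul, norm_pow, Complex.norm_real, Complex.norm_real,
        Real.norm_eq_abs, Real.norm_eq_abs]
      gcongr
      exacts [a0 x, h3 x]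
    have t4 : ‖3 * a x * ((deriv (deriv P) x : ℝ) : ℂ) ^ 2 / ((deriv P x : ℝ) : ℂ) ^ 4‖ ≤
        3 * A * (M * m) ^ 2 / m ^ 4 := by
      rw [norm_div, norm_mul, norm_mul, norm_pow, norm_pow, Complex.norm_real, Complex.norm_real,
        Real.norm_eq_abs, Real.norm_eq_abs, Complex.norm_ofNat]
      gcongr
      exacts [a0 x, h2 x]
    refine (norm_add_le _ _).trans ?_
    refine (add_le_add ((norm_sub_le _ _).trans (add_le_add ((norm_sub_le _ _).trans
      (add_le_add t1 t2)) t3)) t4).trans (le_of_eq ?_)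
    field_simp
    ring
  have hz : ∀ x, x ∉ Set.Icc (-R) R → Complex.exp (Complex.I * (P x : ℂ)) * c x = 0 :=
    fun x hx => by
      rw [image_eq_zero_of_notMem_tsupport (fun h => hx (haR (hcs h))), mul_zero]
  rw [← setIntegral_eq_integral_of_forall_compl_eq_zero hz, norm_mul, norm_mul, Complex.norm_I,
    one_mul, one_mul]
  refine (norm_setIntegral_le_of_norm_le_const (C := A * (1 + 4 * M + 3 * M ^ 2) / m ^ 2)
    (by simp) (fun x _ => ?_)).trans (le_of_eq ?_)
  · rw [norm_mul, mul_comm Complex.I, Complex.norm_exp_ofReal_mul_I, one_mul]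
    exact hbound x
  · rw [Real.volume_real_Icc_of_le (by linarith)]
    ring

open scoped ComplexConjugate ENNReal

/-! ### Cauchy–Schwarz and the TT* inequality. -/

theorem integrable_of_bounded_of_support {α : Type*} [MeasurableSpace α] {μ : Measure α}
    {k : α → ℂ} (hk : Measurable k) {M : ℝ} (hM : ∀ z, ‖k z‖ ≤ M) {s : Set α}
    (hμ : μ s ≠ ⊤) (h : ∀ z, k z ≠ 0 → z ∈ s) : Integrable k μ := by
  have h1 : IntegrableOn k s μ :=
    Measure.integrableOn_of_bounded hμ hk.aestronglyMeasurable (M := M) (by simp [hM])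
  exact (integrableOn_iff_integrable_of_support_subset (fun z hz => h z hz)).1 h1

theorem lintegral_mul_sq_le {α : Type*} [MeasurableSpace α] {μ : Measure α} {f g : α → ℝ≥0∞}
    (hf : AEMeasurable f μ) (hg : AEMeasurable g μ) :
    (∫⁻ x, f x * g x ∂μ) ^ 2 ≤ (∫⁻ x, f x ^ 2 ∂μ) * ∫⁻ x, g x ^ 2 ∂μ := by
  have h := ENNReal.lintegral_mul_le_Lp_mul_Lq μ Real.HolderConjugate.two_two hf hg
  have h2 := pow_le_pow_left' h 2
  refine h2.trans (le_of_eq ?_)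
  rw [mul_pow]
  simp only [← ENNReal.rpow_natCast, ← ENNReal.rpow_mul]
  norm_num

theorem lintegral_mul_shift_le {g : ℝ → ℝ≥0∞} (hg : Measurable g) (s : ℝ) :
    ∫⁻ y, g y * g (y + s) ≤ ∫⁻ y, g y ^ 2 := by
  have h := lintegral_mul_sq_le (μ := volume) hg.aemeasurable
    (hg.comp (measurable_add_const s)).aemeasurable
  simp only [Function.comp_def] at h
  rw [lintegral_add_right_eq_self (fun y => g y ^ 2) s, ← pow_two] at h
  exact (ENNReal.pow_le_pow_left_iff two_ne_zero).1 h

theorem volume_box_ne_top (R : ℝ) :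
    (volume : Measure (ℝ × ℝ)) (Set.Icc (-R) R ×ˢ Set.Icc (-R) R) ≠ ⊤ :=
  (isCompact_Icc.prod isCompact_Icc).measure_lt_top.ne

/-- The `TT*` inequality, with the kernel of `T T*` organised by translation. -/
theorem enorm_integral_mul_integral_sq_le {k : ℝ × ℝ → ℂ} (hk : Measurable k) {M R : ℝ}
    (hM : ∀ z, ‖k z‖ ≤ M)
    (hR : ∀ z, k z ≠ 0 → z ∈ Set.Icc (-R) R ×ˢ Set.Icc (-R) R)
    {h : ℝ → ℂ} (hh : AEMeasurable h) :
    ‖∫ t, h t * ∫ x, k (x, t)‖ₑ ^ 2 ≤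
      (∫⁻ t, ‖h t‖ₑ ^ 2) * ∫⁻ s, ‖∫ z : ℝ × ℝ, k z * conj (k (z.1 + s, z.2))‖ₑ := by
  set T : ℝ → ℂ := fun t => ∫ x, k (x, t) with hT
  have hM0 : 0 ≤ M := (norm_nonneg _).trans (hM 0)
  have hTm : Measurable T :=
    ((hk.comp measurable_swap).stronglyMeasurable.integral_prod_right').measurable
  have hTz : ∀ t, T t ≠ 0 → t ∈ Set.Icc (-R) R := by
    intro t ht
    by_contra hc
    refine ht ?_
    have : ∀ x, k (x, t) = 0 := fun x => by
      by_contra hx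
      exact hc (hR _ hx).2
    simp [hT, this]
  have hTb : ∀ t, ‖T t‖ ≤ M * (volume : Measure ℝ).real (Set.Icc (-R) R) := by
    intro t
    rw [hT]
    simp only
    rw [← setIntegral_eq_integral_of_forall_compl_eq_zero (s := Set.Icc (-R) R)
      (fun x hx => by by_contra hc; exact hx (hR _ hc).1)]
    exact norm_setIntegral_le_of_norm_le_const (by simp) (fun x _ => hM _)
  have step1 : ‖∫ t, h t * T t‖ₑ ^ 2 ≤ (∫⁻ t, ‖h t‖ₑ ^ 2) * ∫⁻ t, ‖T t‖ₑ ^ 2 := by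
    refine le_trans (pow_le_pow_left' (enorm_integral_le_lintegral_enorm _) 2) ?_
    simp only [enorm_mul]
    exact lintegral_mul_sq_le hh.enorm hTm.enorm.aemeasurable
  refine step1.trans (mul_le_mul_right ?_ _)
  set q : ℝ → ℝ × ℝ → ℂ := fun s z => k z * conj (k (z.1 + s, z.2)) with hq
  have hqm : Measurable (Function.uncurry q) := by
    simp only [hq, Function.uncurry_def]
    refine (hk.comp measurable_snd).mul ?_
    refine (Complex.continuous_conj.measurable).comp (hk.comp ?_)
    fun_prop
  have hqi : Integrable (Function.uncurry q) (volume.prod volume) := by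
    refine integrable_of_bounded_of_support hqm (M := M * M) (fun z => ?_)
      -- Both x and x + s lie in [-R, R], which confines s to an interval of twice the size.
      (s := Set.Icc (-(2 * R)) (2 * R) ×ˢ (Set.Icc (-R) R ×ˢ Set.Icc (-R) R))
      ?_ ?_
    · simp only [hq, Function.uncurry_def, norm_mul, RCLike.norm_conj]
      exact mul_le_mul (hM _) (hM _) (norm_nonneg _) hM0
    · exact (isCompact_Icc.prod (isCompact_Icc.prod isCompact_Icc)).measure_lt_top.ne
    · rintro ⟨s, x, t⟩ hz
      simp only [hq, Function.uncurry_def, ne_eq, mul_eq_zero, map_eq_zero, not_or] at hz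
      have h1 := hR _ hz.1
      have h2 := hR _ hz.2
      simp only [Set.mem_prod, Set.mem_Icc] at h1 h2 ⊢
      refine ⟨⟨?_, ?_⟩, h1⟩ <;> linarith
  -- In |T|² the second integration variable is x + s; Fubini then brings s to the outside.
  have hTT : ∀ t, T t * conj (T t) = ∫ x, ∫ s, q s (x, t) := by
    intro t
    simp only [hq]
    have : ∀ x, ∫ s, k (x, t) * conj (k (x + s, t)) = k (x, t) * conj (T t) := by
      intro x
      rw [integral_const_mul, integral_conj, integral_add_left_eq_self (fun y => k (y, t)) x]
    simp only [this]
    rw [integral_mul_const]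
  have hswap : ∫ t, T t * conj (T t) = ∫ s, ∫ z, q s z := by
    rw [integral_integral_swap hqi]
    have hqi' : Integrable (fun z : ℝ × ℝ => ∫ s, q s z) (volume.prod volume) :=
      hqi.integral_prod_right
    rw [show (volume : Measure (ℝ × ℝ)) = volume.prod volume from rfl, integral_prod _ hqi',
      integral_integral_swap hqi']
    exact integral_congr_ae (Filter.Eventually.of_forall hTT)
  have hTT2 : ∫⁻ t, ‖T t‖ₑ ^ 2 = ‖∫ t, T t * conj (T t)‖ₑ := by
    have e1 : ∀ t, T t * conj (T t) = ((‖T t‖ ^ 2 : ℝ) : ℂ) := fun t => by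
      rw [Complex.mul_conj, Complex.normSq_eq_norm_sq]
    simp only [e1]
    rw [integral_complex_ofReal]
    have hint : Integrable fun t => ‖T t‖ ^ 2 := by
      have : Integrable fun t => T t * conj (T t) :=
        integrable_of_bounded_of_support (hTm.mul (Complex.continuous_conj.measurable.comp hTm))
          (M := (M * (volume : Measure ℝ).real (Set.Icc (-R) R)) ^ 2) (fun t => by
            simp only [norm_mul, RCLike.norm_conj, ← pow_two]
            exact pow_le_pow_left₀ (norm_nonneg _) (hTb t) 2)
          (s := Set.Icc (-R) R) (by simp)
          (fun t ht => hTz t (left_ne_zero_of_mul ht))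
      simpa [RCLike.norm_conj, ← pow_two] using this.norm
    have hnn : 0 ≤ ∫ t, ‖T t‖ ^ 2 := integral_nonneg fun t => by positivity
    rw [← ofReal_norm, Complex.norm_real, Real.norm_of_nonneg hnn,
      ofReal_integral_eq_lintegral_ofReal hint (Filter.Eventually.of_forall fun t => by positivity)]
    refine lintegral_congr fun t => ?_
    rw [ENNReal.ofReal_pow (norm_nonneg _), ofReal_norm]
  rw [hTT2, hswap]
  exact enorm_integral_le_lintegral_enorm _

/-! ### Hörmander's bound for the shifted kernels. -/

/-- Smooth functions on the line which are bounded by `B` together with two derivatives. -/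
def BoundedToOrderTwo (B : ℝ) (a : ℝ → ℂ) : Prop :=
  ContDiff ℝ ∞ a ∧ ∀ x, ‖a x‖ ≤ B ∧ ‖deriv a x‖ ≤ B ∧ ‖deriv (deriv a) x‖ ≤ B

/-- The factor 4 is the sum 1 + 2 + 1 of the coefficients in the Leibniz rule for the second
derivative. -/
theorem BoundedToOrderTwo.mul {A B : ℝ} {a b : ℝ → ℂ} (ha : BoundedToOrderTwo A a)
    (hb : BoundedToOrderTwo B b) : BoundedToOrderTwo (4 * (A * B)) (fun x => a x * b x) := by
  obtain ⟨ha, ha'⟩ := ha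
  obtain ⟨hb, hb'⟩ := hb
  have dd : ∀ {c : ℝ → ℂ}, ContDiff ℝ ∞ c → ∀ t, HasDerivAt c (deriv c t) t := fun hc t =>
    ((hc.differentiable (by simp)) t).hasDerivAt
  have ha1 : ContDiff ℝ ∞ (deriv a) := (contDiff_infty_iff_deriv.1 ha).2
  have hb1 : ContDiff ℝ ∞ (deriv b) := (contDiff_infty_iff_deriv.1 hb).2
  have e1 : deriv (fun x => a x * b x) = fun x => deriv a x * b x + a x * deriv b x :=
    funext fun x => ((dd ha x).mul (dd hb x)).deriv
  have e2 : ∀ x, deriv (fun x => deriv a x * b x + a x * deriv b x) x =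
      deriv (deriv a) x * b x + deriv a x * deriv b x +
        (deriv a x * deriv b x + a x * deriv (deriv b) x) := fun x =>
    (((dd ha1 x).mul (dd hb x)).add ((dd ha x).mul (dd hb1 x))).deriv
  have hA : 0 ≤ A := (norm_nonneg _).trans (ha' 0).1
  have hB : 0 ≤ B := (norm_nonneg _).trans (hb' 0).1
  have m : ∀ {u v : ℂ}, ‖u‖ ≤ A → ‖v‖ ≤ B → ‖u * v‖ ≤ A * B := fun hu hv => by
    rw [norm_mul]; exact mul_le_mul hu hv (norm_nonneg _) hA
  have hAB : 0 ≤ A * B := mul_nonneg hA hB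
  refine ⟨ha.mul hb, fun x => ⟨?_, ?_, ?_⟩⟩
  · linarith [m (ha' x).1 (hb' x).1]
  · rw [e1]
    refine (norm_add_le _ _).trans ?_
    linarith [m (ha' x).2.1 (hb' x).1, m (ha' x).1 (hb' x).2.1]
  · rw [e1, e2]
    refine (norm_add_le _ _).trans ((add_le_add (norm_add_le _ _) (norm_add_le _ _)).trans ?_)
    linarith [m (ha' x).2.2 (hb' x).1, m (ha' x).1 (hb' x).2.2, m (ha' x).2.1 (hb' x).2.1]

theorem BoundedToOrderTwo.conj {B : ℝ} {a : ℝ → ℂ} (ha : BoundedToOrderTwo B a) :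
    BoundedToOrderTwo B (fun x => conj (a x)) := by
  obtain ⟨ha, ha'⟩ := ha
  have dd : ∀ {c : ℝ → ℂ}, ContDiff ℝ ∞ c →
      deriv (fun x => conj (c x)) = fun x => conj (deriv c x) := fun hc => funext fun t =>
    (Complex.conjCLE.toContinuousLinearMap.hasFDerivAt.comp_hasDerivAt t
      ((hc.differentiable (by simp)) t).hasDerivAt).deriv
  have ha1 : ContDiff ℝ ∞ (deriv a) := (contDiff_infty_iff_deriv.1 ha).2
  refine ⟨Complex.conjCLE.toContinuousLinearMap.contDiff.comp ha, fun x => ?_⟩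
  rw [dd ha, dd ha1]
  simpa only [RCLike.norm_conj] using ha' x

theorem BoundedToOrderTwo.shift {B : ℝ} {a : ℝ → ℂ} (ha : BoundedToOrderTwo B a) (s : ℝ) :
    BoundedToOrderTwo B (fun x => a (x + s)) := by
  refine ⟨ha.1.comp (contDiff_id.add contDiff_const), fun x => ?_⟩
  have e : ∀ c : ℝ → ℂ, deriv (fun x => c (x + s)) = fun x => deriv c (x + s) := fun c =>
    funext fun x => deriv_comp_add_const c s x
  rw [e, e]
  exact ha.2 (x + s)

theorem exists_boundedToOrderTwo_slice {φ : ℝ × ℝ → ℂ} (hφ : ContDiff ℝ ∞ φ)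
    (hφc : HasCompactSupport φ) :
    ∃ B, ∀ y, BoundedToOrderTwo B (fun x => φ (x, y)) := by
  have h1 := contDiff_dirDeriv hφ (1, 0)
  have h2 := contDiff_dirDeriv h1 (1, 0)
  have c1 := hφc.fderiv_apply (𝕜 := ℝ) (1, 0)
  have c2 := c1.fderiv_apply (𝕜 := ℝ) (1, 0)
  obtain ⟨B0, hB0⟩ := hφc.exists_bound_of_continuous hφ.continuous
  obtain ⟨B1, hB1⟩ := c1.exists_bound_of_continuous h1.continuous
  obtain ⟨B2, hB2⟩ := c2.exists_bound_of_continuous h2.continuous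
  refine ⟨max B0 (max B1 B2), fun y =>
    ⟨hφ.comp (contDiff_id.prodMk contDiff_const), fun x => ?_⟩⟩
  have e1 : deriv (fun x => φ (x, y)) = fun x => dirDeriv (1, 0) φ (x, y) :=
    funext fun x => (hasDerivAt_fst hφ x y).deriv
  have e2 : deriv (fun x => dirDeriv (1, 0) φ (x, y)) =
      fun x => dirDeriv (1, 0) (dirDeriv (1, 0) φ) (x, y) :=
    funext fun x => (hasDerivAt_fst h1 x y).deriv
  rw [e1, e2]
  exact ⟨(hB0 _).trans (le_max_left _ _),
    (hB1 _).trans ((le_max_left _ _).trans (le_max_right _ _)),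
    (hB2 _).trans ((le_max_right _ _).trans (le_max_right _ _))⟩

/-- The second difference of `F` over a parallelogram with sides parallel to `(1, -1)` and
`(0, 1)`. -/
def secondDiff (F : ℝ × ℝ → ℝ) (s y y' x : ℝ) : ℝ :=
  F (x, y) - F (x + s, y - s) - F (x, y') + F (x + s, y' - s)

theorem hasDerivAt_secondDiff {F : ℝ × ℝ → ℝ} (hF : ContDiff ℝ ∞ F) (s y y' x : ℝ) :
    HasDerivAt (secondDiff F s y y') (secondDiff (dirDeriv (1, 0) F) s y y' x) x :=
  (((hasDerivAt_fst hF x y).sub ((hasDerivAt_fst hF (x + s) (y - s)).comp_add_const x s)).sub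
    (hasDerivAt_fst hF x y')).add ((hasDerivAt_fst hF (x + s) (y' - s)).comp_add_const x s)

theorem contDiff_secondDiff {F : ℝ × ℝ → ℝ} (hF : ContDiff ℝ ∞ F) (s y y' : ℝ) :
    ContDiff ℝ ∞ (secondDiff F s y y') := by
  have h : ∀ a b : ℝ, ContDiff ℝ ∞ fun x : ℝ => F (x + a, b) := fun a b =>
    hF.comp ((contDiff_id.add contDiff_const).prodMk contDiff_const)
  have h' : ∀ b : ℝ, ContDiff ℝ ∞ fun x : ℝ => F (x, b) := fun b =>
    hF.comp (contDiff_id.prodMk contDiff_const)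
  exact (((h' y).sub (h s (y - s))).sub (h' y')).add (h s (y' - s))

/-- The point `w` is chosen before `K`, so the identity serves both for upper bounds valid
everywhere and for the lower bound on the convex hull. -/
theorem exists_secondDiff_eq {F : ℝ × ℝ → ℝ} (hF : ContDiff ℝ ∞ F) (s y y' x : ℝ) :
    ∃ w, secondDiff F s y y' x = s * (y' - y) * dirDeriv (1, -1) (dirDeriv (0, 1) F) w ∧
      ∀ K : Set (ℝ × ℝ), Convex ℝ K → (x, y) ∈ K → (x + s, y - s) ∈ K → (x, y') ∈ K →
        (x + s, y' - s) ∈ K → w ∈ K := by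
  obtain ⟨a, ha, b, hb, h⟩ :=
    exists_second_difference hF (x, y) (s • ((1 : ℝ), (-1 : ℝ))) ((y' - y) • ((0 : ℝ), (1 : ℝ)))
  refine ⟨_, ?_, fun K hK h1 h2 h3 h4 => parallelogram_mem (u := s • ((1 : ℝ), (-1 : ℝ)))
    (v := (y' - y) • ((0 : ℝ), (1 : ℝ))) hK h1 ?_ ?_ ?_ ha hb⟩
  · rw [dirDeriv_smul_dir, dirDeriv_smul_dir,
      dirDeriv_const_mul (contDiff_dirDeriv hF _)] at h
    beta_reduce at h
    rw [mul_assoc, ← h, secondDiff]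
    simp only [Prod.smul_mk, Prod.mk_add_mk, smul_eq_mul, mul_one, mul_zero, add_zero, mul_neg]
    rw [show y + (y' - y) = y' by ring, show y + -s + (y' - y) = y' - s by ring,
      show y + -s = y - s by ring]
    ring
  all_goals simp only [Prod.smul_mk, Prod.mk_add_mk, smul_eq_mul, mul_one, mul_zero, add_zero,
    mul_neg]
  · rwa [← sub_eq_add_neg]
  · rwa [show y + (y' - y) = y' by ring]
  · rwa [show y + -s + (y' - y) = y' - s by ring]

/-- The oscillatory kernel obtained by multiplying `e^{iλS} φ` with the complex conjugate of its
translate along `(1, -1)`. -/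
noncomputable def shiftKernel (lam : ℝ) (S : ℝ × ℝ → ℝ) (φ : ℝ × ℝ → ℂ) (s : ℝ) (z : ℝ × ℝ) : ℂ :=
  Complex.exp (Complex.I * ((lam * S z : ℝ) : ℂ)) * φ z *
    conj (Complex.exp (Complex.I * ((lam * S (z.1 + s, z.2 - s) : ℝ) : ℂ)) *
      φ (z.1 + s, z.2 - s))

theorem conj_exp_I_mul (t : ℝ) :
    conj (Complex.exp (Complex.I * (t : ℂ))) = Complex.exp (Complex.I * ((-t : ℝ) : ℂ)) := by
  rw [← Complex.exp_conj]
  simp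

theorem norm_exp_I_mul (t : ℝ) : ‖Complex.exp (Complex.I * (t : ℂ))‖ = 1 := by
  rw [mul_comm, Complex.norm_exp_ofReal_mul_I]

theorem opD_eq_of_partial_first {S : ℝ × ℝ → ℝ} (hS : ContDiff ℝ ∞ S) :
    dirDeriv (1, -1) (dirDeriv (0, 1) (dirDeriv (1, 0) S)) = opD S := by
  rw [opD_eq hS, dirDeriv_comm hS (0, 1), dirDeriv_comm (contDiff_dirDeriv hS _) (1, -1),
    dirDeriv_comm hS (1, -1)]

theorem exists_tsupport_subset_box {φ : ℝ × ℝ → ℂ} (hφc : HasCompactSupport φ) :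
    ∃ R, 0 ≤ R ∧ tsupport φ ⊆ Set.Icc (-R) R ×ˢ Set.Icc (-R) R := by
  obtain ⟨R, hR⟩ := hφc.isBounded.exists_norm_le
  refine ⟨max R 0, le_max_right _ _, fun z hz => ?_⟩
  have h := (hR z hz).trans (le_max_left R 0)
  rw [Prod.norm_def, max_le_iff, Real.norm_eq_abs, Real.norm_eq_abs, abs_le, abs_le] at h
  exact ⟨h.1, h.2⟩

/-- The product of kernels has phase λ times the second difference of S in x. With m = |λs(y'-y)|,
its first derivative is at least m on the support of the amplitude, and the next two are at most M·m
with M depending on S alone. Nonstationary phase gives O(m⁻²), and the trivial bound covers small m.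
Quadratic decay makes the bound integrable in y' - y. -/
theorem exists_norm_integral_shiftKernel_le {S : ℝ × ℝ → ℝ} (hS : ContDiff ℝ ∞ S)
    (hSc : HasCompactSupport S) {φ : ℝ × ℝ → ℂ} (hφ : ContDiff ℝ ∞ φ) (hφc : HasCompactSupport φ)
    (hD : ∀ z ∈ convexHull ℝ (tsupport φ), 1 ≤ |opD S z|) :
    ∃ C, 0 ≤ C ∧ ∀ lam s y y' : ℝ,
      ‖∫ x, shiftKernel lam S φ s (x, y) * conj (shiftKernel lam S φ s (x, y'))‖ ≤
        C / (1 + (lam * s * (y' - y)) ^ 2) := by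
  obtain ⟨B, hB⟩ := exists_boundedToOrderTwo_slice hφ hφc
  obtain ⟨R, hR0, hR⟩ := exists_tsupport_subset_box hφc
  set S1 := dirDeriv (1, 0) S with hS1
  set S2 := dirDeriv (1, 0) S1 with hS2
  set S3 := dirDeriv (1, 0) S2 with hS3
  have cS1 : ContDiff ℝ ∞ S1 := contDiff_dirDeriv hS _
  have cS2 : ContDiff ℝ ∞ S2 := contDiff_dirDeriv cS1 _
  have cS3 : ContDiff ℝ ∞ S3 := contDiff_dirDeriv cS2 _
  have kS2 : HasCompactSupport S2 :=
    hasCompactSupport_dirDeriv (hasCompactSupport_dirDeriv hSc _) _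
  have kS3 : HasCompactSupport S3 := hasCompactSupport_dirDeriv kS2 _
  obtain ⟨M2, hM2⟩ := (hasCompactSupport_dirDeriv (hasCompactSupport_dirDeriv kS2 (0, 1))
    (1, -1)).exists_bound_of_continuous
    (contDiff_dirDeriv (contDiff_dirDeriv cS2 (0, 1)) (1, -1)).continuous
  obtain ⟨M3, hM3⟩ := (hasCompactSupport_dirDeriv (hasCompactSupport_dirDeriv kS3 (0, 1))
    (1, -1)).exists_bound_of_continuous
    (contDiff_dirDeriv (contDiff_dirDeriv cS3 (0, 1)) (1, -1)).continuous
  set M := max M2 M3 with hM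
  have hM0 : 0 ≤ M := ((norm_nonneg _).trans (hM2 0)).trans (le_max_left _ _)
  set A := 4 * (4 * (B * B) * (4 * (B * B))) with hA
  have hB0 : 0 ≤ B := (norm_nonneg _).trans ((hB 0).2 0).1
  have hA0 : 0 ≤ A := by positivity
  set T := A * (2 * R) with hT
  set T' := A * (1 + 4 * M + 3 * M ^ 2) * (2 * R) with hT'
  refine ⟨T + T', by positivity, fun lam s y y' => ?_⟩
  set P : ℝ → ℝ := fun x => lam * secondDiff S s y y' x with hP
  set a : ℝ → ℂ := fun x => (φ (x, y) * conj (φ (x + s, y - s))) *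
    (conj (φ (x, y')) * φ (x + s, y' - s)) with ha
  have hab : BoundedToOrderTwo A a :=
    ((hB y).mul ((hB (y - s)).shift s).conj).mul ((hB y').conj.mul ((hB (y' - s)).shift s))
  have hint : ∀ x, shiftKernel lam S φ s (x, y) * conj (shiftKernel lam S φ s (x, y')) =
      Complex.exp (Complex.I * (P x : ℂ)) * a x := by
    intro x
    have e : P x = lam * S (x, y) + -(lam * S (x + s, y - s)) + -(lam * S (x, y')) +
        lam * S (x + s, y' - s) := by simp only [hP, secondDiff]; ring
    rw [e]
    simp only [shiftKernel, map_mul, Complex.conj_conj, conj_exp_I_mul, neg_neg, Complex.ofReal_add,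
      mul_add, Complex.exp_add, ha]
    ring
  simp only [hint]
  -- The condition on the four corners is closed in x, so it passes from the support to its closure.
  have hsupp : ∀ x ∈ tsupport a, (x, y) ∈ tsupport φ ∧ (x + s, y - s) ∈ tsupport φ ∧
      (x, y') ∈ tsupport φ ∧ (x + s, y' - s) ∈ tsupport φ := by
    have hcl : IsClosed {x : ℝ | (x, y) ∈ tsupport φ ∧ (x + s, y - s) ∈ tsupport φ ∧
        (x, y') ∈ tsupport φ ∧ (x + s, y' - s) ∈ tsupport φ} := by
      have h : ∀ f : ℝ → ℝ × ℝ, Continuous f → IsClosed {x | f x ∈ tsupport φ} :=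
        fun f hf => (isClosed_tsupport φ).preimage hf
      exact (h _ (by fun_prop)).inter ((h _ (by fun_prop)).inter
        ((h _ (by fun_prop)).inter (h _ (by fun_prop))))
    refine closure_minimal (fun x hx => ?_) hcl
    simp only [ha, Function.mem_support, ne_eq, mul_eq_zero, map_eq_zero, not_or] at hx
    exact ⟨subset_tsupport φ hx.1.1, subset_tsupport φ hx.1.2, subset_tsupport φ hx.2.1,
      subset_tsupport φ hx.2.2⟩
  have haR : tsupport a ⊆ Set.Icc (-R) R := fun x hx => (hR (hsupp x hx).1).1
  have d1 : deriv P = fun x => lam * secondDiff S1 s y y' x :=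
    funext fun x => ((hasDerivAt_secondDiff hS s y y' x).const_mul lam).deriv
  have d2 : deriv (deriv P) = fun x => lam * secondDiff S2 s y y' x := by
    rw [d1]
    exact funext fun x => ((hasDerivAt_secondDiff cS1 s y y' x).const_mul lam).deriv
  have d3 : deriv (deriv (deriv P)) = fun x => lam * secondDiff S3 s y y' x := by
    rw [d2]
    exact funext fun x => ((hasDerivAt_secondDiff cS2 s y y' x).const_mul lam).deriv
  set m := |lam * s * (y' - y)| with hm
  have hm2 : (lam * s * (y' - y)) ^ 2 = m ^ 2 := by rw [hm, sq_abs]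
  have triv : ‖∫ x, Complex.exp (Complex.I * (P x : ℂ)) * a x‖ ≤ T := by
    have hz : ∀ x, x ∉ Set.Icc (-R) R → Complex.exp (Complex.I * (P x : ℂ)) * a x = 0 :=
      fun x hx => by
        rw [image_eq_zero_of_notMem_tsupport (fun h => hx (haR h)), mul_zero]
    rw [← setIntegral_eq_integral_of_forall_compl_eq_zero hz]
    refine (norm_setIntegral_le_of_norm_le_const (C := A) (by simp) (fun x _ => ?_)).trans
      (le_of_eq ?_)
    · rw [norm_mul, norm_exp_I_mul, one_mul]
      exact (hab.2 x).1
    · rw [Real.volume_real_Icc_of_le (by linarith)]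
      ring
  rw [hm2, le_div_iff₀ (by positivity), mul_add, mul_one]
  refine add_le_add triv ?_
  rcases (abs_nonneg (lam * s * (y' - y))).eq_or_lt with h0 | hpos
  · rw [hm, ← h0]
    simp only [ne_eq, OfNat.ofNat_ne_zero, not_false_eq_true, zero_pow, mul_zero]
    positivity
  rw [← le_div_iff₀ (by positivity)]
  have hbd : ∀ (F : ℝ × ℝ → ℝ) (c : ℝ), ContDiff ℝ ∞ F →
      (∀ z, ‖dirDeriv (1, -1) (dirDeriv (0, 1) F) z‖ ≤ c) →
      ∀ x, |lam * secondDiff F s y y' x| ≤ c * m := by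
    intro F c hF hc x
    obtain ⟨w, hw, -⟩ := exists_secondDiff_eq hF s y y' x
    rw [hw, ← mul_assoc, ← mul_assoc, abs_mul, mul_comm, ← hm]
    exact mul_le_mul_of_nonneg_right (hc w) (abs_nonneg _)
  refine norm_integral_exp_mul_le hab.1 (contDiff_const.mul (contDiff_secondDiff hS s y y')) haR
    hR0 hpos hM0 hA0 (fun x hx => ?_) (fun x => ?_) (fun x => ?_) (fun x => (hab.2 x).1)
    (fun x => (hab.2 x).2.1) (fun x => (hab.2 x).2.2)
  · obtain ⟨w, hw, hK⟩ := exists_secondDiff_eq cS1 s y y' x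
    obtain ⟨h1, h2, h3, h4⟩ := hsupp x hx
    have hsub := subset_convexHull ℝ (tsupport φ)
    have hwK := hK _ (convex_convexHull ℝ (tsupport φ)) (hsub h1) (hsub h2) (hsub h3) (hsub h4)
    rw [hS1, opD_eq_of_partial_first hS] at hw
    have := hD w hwK
    rw [d1]
    simp only
    rw [hw, ← mul_assoc, ← mul_assoc, abs_mul]
    exact le_mul_of_one_le_right (abs_nonneg _) this
  · rw [d2]
    exact hbd S2 M cS2 (fun z => (hM2 z).trans (le_max_left _ _)) x
  · rw [d3]
    exact hbd S3 M cS3 (fun z => (hM3 z).trans (le_max_right _ _)) x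

theorem measurable_shiftKernel {S : ℝ × ℝ → ℝ} (hS : Continuous S) {φ : ℝ × ℝ → ℂ}
    (hφ : Continuous φ) (lam s : ℝ) : Measurable (shiftKernel lam S φ s) := by
  refine Continuous.measurable ?_
  unfold shiftKernel
  refine Continuous.mul (by fun_prop) (Complex.continuous_conj.comp (by fun_prop))

theorem norm_shiftKernel (lam : ℝ) (S : ℝ × ℝ → ℝ) (φ : ℝ × ℝ → ℂ) (s : ℝ) (z : ℝ × ℝ) :
    ‖shiftKernel lam S φ s z‖ = ‖φ z‖ * ‖φ (z.1 + s, z.2 - s)‖ := by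
  simp only [shiftKernel, norm_mul, RCLike.norm_conj, norm_exp_I_mul, one_mul]

theorem lintegral_ofReal_div_one_add_sq (C c : ℝ) (hC : 0 ≤ C) (hc : c ≠ 0) :
    ∫⁻ t : ℝ, ENNReal.ofReal (C / (1 + (c * t) ^ 2)) = ENNReal.ofReal (C * Real.pi / |c|) := by
  have h1 : Integrable fun t : ℝ => (1 + (c * t) ^ 2)⁻¹ :=
    integrable_inv_one_add_sq.comp_mul_left' hc
  simp only [div_eq_mul_inv]
  rw [← ofReal_integral_eq_lintegral_ofReal (h1.const_mul C)
    (Filter.Eventually.of_forall fun t => by positivity), integral_const_mul,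
    Measure.integral_comp_mul_left (fun t : ℝ => (1 + t ^ 2)⁻¹) c, integral_univ_inv_one_add_sq]
  congr 1
  rw [abs_inv, smul_eq_mul]
  ring

/-- Hörmander's `L²` bound for the operators with kernel `shiftKernel`, uniformly in the shift. -/
theorem exists_enorm_integral_shiftKernel_sq_le {S : ℝ × ℝ → ℝ} (hS : ContDiff ℝ ∞ S)
    (hSc : HasCompactSupport S) {φ : ℝ × ℝ → ℂ} (hφ : ContDiff ℝ ∞ φ) (hφc : HasCompactSupport φ)
    (hD : ∀ z ∈ convexHull ℝ (tsupport φ), 1 ≤ |opD S z|) :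
    ∃ C : ℝ, 0 ≤ C ∧ ∀ lam s : ℝ, lam ≠ 0 → s ≠ 0 → ∀ F G : ℝ → ℂ, Measurable F → Measurable G →
      (∃ M, ∀ x, ‖F x‖ ≤ M) → (∃ M, ∀ x, ‖G x‖ ≤ M) →
      ‖∫ z : ℝ × ℝ, shiftKernel lam S φ s z * F z.1 * G z.2‖ₑ ^ 2 ≤
        ENNReal.ofReal (C / (|lam| * |s|)) * (∫⁻ x, ‖F x‖ₑ ^ 2) * ∫⁻ y, ‖G y‖ₑ ^ 2 := by
  obtain ⟨C, hC0, hC⟩ := exists_norm_integral_shiftKernel_le hS hSc hφ hφc hD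
  obtain ⟨R, hR0, hR⟩ := exists_tsupport_subset_box hφc
  obtain ⟨B, hB⟩ := hφc.exists_bound_of_continuous hφ.continuous
  have hB0 : 0 ≤ B := (norm_nonneg _).trans (hB 0)
  refine ⟨C * Real.pi, by positivity, ?_⟩
  rintro lam σ hlam hσ F G hF hG ⟨MF, hMF⟩ ⟨MG, hMG⟩
  have hMF0 : 0 ≤ MF := (norm_nonneg _).trans (hMF 0)
  have hMG0 : 0 ≤ MG := (norm_nonneg _).trans (hMG 0)
  set κ := shiftKernel lam S φ σ with hκ
  have hκm : Measurable κ := measurable_shiftKernel hS.continuous hφ.continuous lam σ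
  have hκb : ∀ z, ‖κ z‖ ≤ B * B := fun z => by
    rw [hκ, norm_shiftKernel]
    exact mul_le_mul (hB _) (hB _) (norm_nonneg _) hB0
  have hκs : ∀ z, κ z ≠ 0 → z ∈ Set.Icc (-R) R ×ˢ Set.Icc (-R) R := by
    intro z hz
    refine hR (subset_tsupport φ fun h => hz ?_)
    simp [hκ, shiftKernel, h]
  -- The TT* inequality integrates the first coordinate inside, so that coordinate is y here; `F`
  -- takes the place of the outer function.
  set k : ℝ × ℝ → ℂ := fun w => κ (w.2, w.1) * G w.1 with hk
  have hkm : Measurable k := (hκm.comp measurable_swap).mul (hG.comp measurable_fst)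
  have hkb : ∀ w, ‖k w‖ ≤ B * B * MG := fun w => by
    rw [hk, norm_mul]
    exact mul_le_mul (hκb _) (hMG _) (norm_nonneg _) (by positivity)
  have hks : ∀ w, k w ≠ 0 → w ∈ Set.Icc (-R) R ×ˢ Set.Icc (-R) R := fun w hw =>
    (hκs _ (left_ne_zero_of_mul hw)).symm
  have hint : Integrable (fun z : ℝ × ℝ => κ z * F z.1 * G z.2) (volume.prod volume) := by
    refine integrable_of_bounded_of_support ((hκm.mul (hF.comp measurable_fst)).mul
      (hG.comp measurable_snd)) (M := B * B * MF * MG) (fun z => ?_) (volume_box_ne_top R)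
      (fun z hz => hκs z (left_ne_zero_of_mul (left_ne_zero_of_mul hz)))
    simp only [norm_mul]
    exact mul_le_mul (mul_le_mul (hκb _) (hMF _) (norm_nonneg _) (by positivity)) (hMG _)
      (norm_nonneg _) (by positivity)
  have e1 : ∫ z : ℝ × ℝ, κ z * F z.1 * G z.2 = ∫ x, F x * ∫ y, k (y, x) := by
    rw [show (volume : Measure (ℝ × ℝ)) = volume.prod volume from rfl, integral_prod _ hint]
    refine integral_congr_ae (Filter.Eventually.of_forall fun x => ?_)
    simp only [hk]
    rw [← integral_const_mul]
    refine integral_congr_ae (Filter.Eventually.of_forall fun y => ?_)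
    simp only
    ring
  -- For y' = y + t the kernel of TT* is bounded by a function of t alone, and the correlation of
  -- |G| with its translate is at most ‖G‖₂². Integrating in t then yields a factor of order 1/|λσ|.
  have e2 : ∀ t, ‖∫ w : ℝ × ℝ, k w * conj (k (w.1 + t, w.2))‖ₑ ≤
      ENNReal.ofReal (C / (1 + (lam * σ * t) ^ 2)) * ∫⁻ y, ‖G y‖ₑ ^ 2 := by
    intro t
    have hi : Integrable (fun w : ℝ × ℝ => k w * conj (k (w.1 + t, w.2)))
        (volume.prod volume) := by
      refine integrable_of_bounded_of_support (hkm.mul (Complex.continuous_conj.measurable.comp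
        (hkm.comp (by fun_prop)))) (M := B * B * MG * (B * B * MG)) (fun w => ?_)
        (volume_box_ne_top R) (fun w hw => hks w (left_ne_zero_of_mul hw))
      simp only [norm_mul, RCLike.norm_conj]
      exact mul_le_mul (hkb _) (hkb _) (norm_nonneg _) (by positivity)
    rw [show (volume : Measure (ℝ × ℝ)) = volume.prod volume from rfl, integral_prod _ hi]
    refine (enorm_integral_le_lintegral_enorm _).trans ?_
    have hb : ∀ y, ‖∫ x, k (y, x) * conj (k (y + t, x))‖ₑ ≤
        ENNReal.ofReal (C / (1 + (lam * σ * t) ^ 2)) * (‖G y‖ₑ * ‖G (y + t)‖ₑ) := by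
      intro y
      have : ∀ x, k (y, x) * conj (k (y + t, x)) =
          κ (x, y) * conj (κ (x, y + t)) * (G y * conj (G (y + t))) := fun x => by
        simp only [hk, map_mul]; ring
      simp only [this]
      rw [integral_mul_const, enorm_mul, enorm_mul]
      refine mul_le_mul' ?_ (le_of_eq ?_)
      · rw [← ofReal_norm]
        refine ENNReal.ofReal_le_ofReal ((hC lam σ y (y + t)).trans (le_of_eq ?_))
        rw [add_sub_cancel_left]
      · rw [← ofReal_norm (conj _), RCLike.norm_conj, ofReal_norm]
    refine (lintegral_mono hb).trans ?_
    rw [lintegral_const_mul' _ _ ENNReal.ofReal_ne_top]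
    exact mul_le_mul_right (lintegral_mul_shift_le hG.enorm t) _
  have main := enorm_integral_mul_integral_sq_le hkm hkb hks hF.aemeasurable
  rw [e1]
  refine main.trans ?_
  rw [mul_comm (ENNReal.ofReal _), mul_assoc]
  refine mul_le_mul_right ((lintegral_mono e2).trans ?_) _
  rw [lintegral_mul_const _ (by fun_prop),
    lintegral_ofReal_div_one_add_sq C _ hC0 (mul_ne_zero hlam hσ), abs_mul]

/-! ### The diagonal Hardy–Littlewood–Sobolev inequality. -/

theorem lintegral_comp_abs (w : ℝ → ℝ≥0∞) :
    ∫⁻ t : ℝ, w |t| = 2 * ∫⁻ t in Set.Ioi (0 : ℝ), w t := by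
  have h1 : ∫⁻ t in Set.Ioi (0 : ℝ), w |t| = ∫⁻ t in Set.Ioi (0 : ℝ), w t :=
    setLIntegral_congr_fun measurableSet_Ioi fun t ht => by
      simp only [abs_of_pos (Set.mem_Ioi.1 ht)]
  have h2 : ∫⁻ t in Set.Iic (0 : ℝ), w |t| = ∫⁻ t in Set.Ioi (0 : ℝ), w t := by
    have := (Measure.measurePreserving_neg (volume : Measure ℝ)).setLIntegral_comp_preimage_emb
      (Homeomorph.neg ℝ).measurableEmbedding (fun t => w |t|) (Set.Ici (0 : ℝ))
    simp only [abs_neg, Set.neg_preimage, Set.neg_Ici, neg_zero] at this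
    rw [this, setLIntegral_congr Ioi_ae_eq_Ici.symm, h1]
  rw [← lintegral_add_compl (fun t => w |t|) (measurableSet_Ioi (a := (0 : ℝ))), Set.compl_Ioi,
    h1, h2, two_mul]

theorem lintegral_near_rpow {a R : ℝ} (ha : a < 1) (hR : 0 < R) :
    ∫⁻ t : ℝ, (if |t| ≤ R then ENNReal.ofReal (|t| ^ (-a)) else 0) =
      ENNReal.ofReal (2 * R ^ (1 - a) / (1 - a)) := by
  rw [lintegral_comp_abs (fun t => if t ≤ R then ENNReal.ofReal (t ^ (-a)) else 0)]
  have h : ∫⁻ t in Set.Ioi (0 : ℝ), (if t ≤ R then ENNReal.ofReal (t ^ (-a)) else 0) =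
      ∫⁻ t in Set.Ioc 0 R, ENNReal.ofReal (t ^ (-a)) := by
    rw [← Set.Ioi_inter_Iic, Set.inter_comm, ← Measure.restrict_restrict measurableSet_Iic,
      ← lintegral_indicator measurableSet_Iic]
    rfl
  have hi : IntegrableOn (fun t : ℝ => t ^ (-a)) (Set.Ioc 0 R) :=
    (intervalIntegrable_iff_integrableOn_Ioc_of_le hR.le).1
      (intervalIntegral.intervalIntegrable_rpow' (by linarith))
  rw [h, ← ofReal_integral_eq_lintegral_ofReal hi
    ((ae_restrict_iff' measurableSet_Ioc).2 (Filter.Eventually.of_forall fun t ht =>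
      Real.rpow_nonneg ht.1.le _)),
    ← intervalIntegral.integral_of_le hR.le, integral_rpow (Or.inl (by linarith)),
    Real.zero_rpow (by linarith), sub_zero, ← ENNReal.ofReal_ofNat, ← ENNReal.ofReal_mul (by simp)]
  congr 1
  rw [show -a + 1 = 1 - a by ring]
  ring

/-- The exponent -2 is what |t|^{-a} with a = 2 - 2/m becomes when raised to the conjugate exponent
m/(m-1). -/
theorem lintegral_far_rpow {R : ℝ} (hR : 0 < R) :
    ∫⁻ t : ℝ, (if |t| ≤ R then 0 else ENNReal.ofReal (|t| ^ (-2 : ℝ))) =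
      ENNReal.ofReal (2 * R⁻¹) := by
  rw [lintegral_comp_abs (fun t => if t ≤ R then 0 else ENNReal.ofReal (t ^ (-2 : ℝ)))]
  have h : ∫⁻ t in Set.Ioi (0 : ℝ), (if t ≤ R then 0 else ENNReal.ofReal (t ^ (-2 : ℝ))) =
      ∫⁻ t in Set.Ioi R, ENNReal.ofReal (t ^ (-2 : ℝ)) := by
    have : Set.Ioi R = Set.Ioi R ∩ Set.Ioi 0 := by
      rw [Set.Ioi_inter_Ioi, sup_of_le_left hR.le]
    rw [this, ← Measure.restrict_restrict measurableSet_Ioi,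
      ← lintegral_indicator (measurableSet_Ioi (a := R))]
    congr 1
    funext t
    by_cases ht : t ≤ R
    · simp [ht]
    · simp [ht, not_le.1 ht]
  rw [h, ← ofReal_integral_eq_lintegral_ofReal
    (integrableOn_Ioi_rpow_of_lt (by norm_num) hR)
    ((ae_restrict_iff' measurableSet_Ioi).2 (Filter.Eventually.of_forall fun t ht =>
      Real.rpow_nonneg (hR.le.trans (le_of_lt ht)) _)),
    integral_Ioi_rpow_of_lt (by norm_num) hR, ← ENNReal.ofReal_ofNat,
    ← ENNReal.ofReal_mul (by simp)]
  congr 1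
  rw [show (-2 : ℝ) + 1 = -1 by norm_num, Real.rpow_neg_one]
  ring

/-- The fractional integral of a function truncated at height `b`. -/
theorem lintegral_rpow_mul_min_le {m : ℝ} (h1 : 1 < m) (h2 : m < 2) {v : ℝ → ℝ≥0∞}
    (hv : Measurable v) {b : ℝ≥0∞} (hb0 : b ≠ 0) (hb : b ≠ ⊤)
    (hJ0 : ∫⁻ t, v t ^ m ≠ 0) (hJ : ∫⁻ t, v t ^ m ≠ ⊤) :
    ∫⁻ t, ENNReal.ofReal (|t| ^ (-(2 - 2 / m))) * min (v t) b ≤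
      ENNReal.ofReal (2 / (2 / m - 1) + 2 ^ (1 - 1 / m)) *
        (b ^ (m - 1) * (∫⁻ t, v t ^ m) ^ (2 / m - 1)) := by
  set J := ∫⁻ t, v t ^ m with hJdef
  have hm0 : 0 < m := by linarith
  obtain ⟨β, hβ, rfl⟩ : ∃ β : ℝ, 0 < β ∧ ENNReal.ofReal β = b :=
    ⟨b.toReal, ENNReal.toReal_pos hb0 hb, ENNReal.ofReal_toReal hb⟩
  obtain ⟨j, hj, hjJ⟩ : ∃ j : ℝ, 0 < j ∧ ENNReal.ofReal j = J :=
    ⟨J.toReal, ENNReal.toReal_pos hJ0 hJ, ENNReal.ofReal_toReal hJ⟩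
  -- This radius balances the two parts: βR^{1-a} from truncation near 0, and J^{1/m}R^{-(1-1/m)}
  -- from Hölder far away, both become β^{m-1}J^{2/m-1} up to constants.
  set R := j / β ^ m with hRdef
  have hR : 0 < R := by positivity
  set a := 2 - 2 / m with ha
  have h2m : 1 < 2 / m := by rw [lt_div_iff₀ hm0]; linarith
  have ha1 : a < 1 := by linarith
  have hconj : m.HolderConjugate (m / (m - 1)) := Real.HolderConjugate.conjExponent h1
  set near : ℝ → ℝ≥0∞ := fun t => if |t| ≤ R then ENNReal.ofReal (|t| ^ (-a)) else 0 with hnear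
  set far : ℝ → ℝ≥0∞ := fun t => if |t| ≤ R then 0 else ENNReal.ofReal (|t| ^ (-a)) with hfar
  have hset : MeasurableSet {t : ℝ | |t| ≤ R} := measurableSet_le (by fun_prop) (by fun_prop)
  have hnm : Measurable near := Measurable.ite hset (by fun_prop) (by fun_prop)
  have hfm : Measurable far := Measurable.ite hset (by fun_prop) (by fun_prop)
  have hpt : ∀ t, ENNReal.ofReal (|t| ^ (-a)) * min (v t) (ENNReal.ofReal β) ≤
      near t * ENNReal.ofReal β + v t * far t := by
    intro t
    simp only [hnear, hfar]
    split_ifs with h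
    · rw [mul_zero, add_zero]
      exact mul_le_mul_right (min_le_right _ _) _
    · rw [zero_mul, zero_add, mul_comm]
      exact mul_le_mul_left (min_le_left _ _) _
  have hfarpow : ∀ t, far t ^ (m / (m - 1)) =
      if |t| ≤ R then 0 else ENNReal.ofReal (|t| ^ (-2 : ℝ)) := by
    intro t
    simp only [hfar]
    split_ifs with h
    · exact ENNReal.zero_rpow_of_pos (by apply div_pos <;> linarith)
    · have ht : 0 < |t| := hR.trans (not_le.1 h)
      rw [ENNReal.ofReal_rpow_of_pos (by positivity), ← Real.rpow_mul ht.le]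
      congr 2
      have : m - 1 ≠ 0 := by linarith
      rw [ha]
      field_simp
  have hH : ∫⁻ t, v t * far t ≤ J ^ (1 / m) * ENNReal.ofReal (2 * R⁻¹) ^ (1 - 1 / m) := by
    have h := ENNReal.lintegral_mul_le_Lp_mul_Lq volume hconj hv.aemeasurable hfm.aemeasurable
    simp only [hfarpow] at h
    rw [lintegral_far_rpow hR] at h
    have he : 1 / (m / (m - 1)) = 1 - 1 / m := by field_simp
    rw [he] at h
    exact h
  calc ∫⁻ t, ENNReal.ofReal (|t| ^ (-a)) * min (v t) (ENNReal.ofReal β)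
      ≤ ∫⁻ t, (near t * ENNReal.ofReal β + v t * far t) := lintegral_mono hpt
    _ = (∫⁻ t, near t) * ENNReal.ofReal β + ∫⁻ t, v t * far t := by
        rw [lintegral_add_left (by fun_prop), lintegral_mul_const _ hnm]
    _ ≤ ENNReal.ofReal (2 * R ^ (1 - a) / (1 - a)) * ENNReal.ofReal β +
          J ^ (1 / m) * ENNReal.ofReal (2 * R⁻¹) ^ (1 - 1 / m) := by
        rw [hnear, lintegral_near_rpow ha1 hR]
        exact add_le_add_right hH _
    _ = ENNReal.ofReal (2 / (2 / m - 1) + 2 ^ (1 - 1 / m)) *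
        (ENNReal.ofReal β ^ (m - 1) * J ^ (2 / m - 1)) := by
        have hm1 : 0 ≤ 1 - 1 / m := by
          rw [sub_nonneg, div_le_one hm0]; exact h1.le
        have h1a : 0 < 1 - a := by linarith
        rw [← hjJ, ENNReal.ofReal_rpow_of_pos hj, ENNReal.ofReal_rpow_of_pos (by positivity),
          ENNReal.ofReal_rpow_of_pos hβ, ENNReal.ofReal_rpow_of_pos hj,
          ← ENNReal.ofReal_mul (by positivity), ← ENNReal.ofReal_mul (by positivity),
          ← ENNReal.ofReal_mul (by positivity),
          ← ENNReal.ofReal_add (by positivity) (by positivity),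
          ← ENNReal.ofReal_mul (by have : 0 < 2 / m - 1 := by linarith
                                   positivity)]
        congr 1
        have e1 : R ^ (1 - a) * β = β ^ (m - 1) * j ^ (2 / m - 1) := by
          rw [hRdef, Real.div_rpow hj.le (by positivity), ← Real.rpow_mul hβ.le,
            show 1 - a = 2 / m - 1 by rw [ha]; ring, div_mul_eq_mul_div, div_eq_iff (by positivity),
            mul_right_comm, ← Real.rpow_add hβ,
            show m - 1 + m * (2 / m - 1) = 1 by field_simp; ring, Real.rpow_one, mul_comm]
        have e2 : j ^ (1 / m) * R⁻¹ ^ (1 - 1 / m) = β ^ (m - 1) * j ^ (2 / m - 1) := by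
          rw [hRdef, inv_div, Real.div_rpow (by positivity) hj.le, ← Real.rpow_mul hβ.le,
            ← mul_div_assoc, div_eq_iff (by positivity), mul_assoc, ← Real.rpow_add hj,
            show 2 / m - 1 + (1 - 1 / m) = 1 / m by ring,
            show m * (1 - 1 / m) = m - 1 by field_simp, mul_comm]
        rw [Real.mul_rpow (by norm_num) (by positivity), add_mul]
        congr 1
        · rw [← e1, show 1 - a = 2 / m - 1 by rw [ha]; ring]
          ring
        · rw [← e2]
          ring

/-- The diagonal Hardy–Littlewood–Sobolev inequality on the line. -/
theorem exists_lintegral_rpow_mul_lintegral_mul_shift_le {m : ℝ} (h1 : 1 < m) (h2 : m < 2) :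
    ∃ C : ℝ, 0 < C ∧ ∀ u : ℝ → ℝ≥0∞, Measurable u → (∀ x, u x ≠ ⊤) →
      ∫⁻ s, ENNReal.ofReal (|s| ^ (-(2 - 2 / m))) * ∫⁻ x, u x * u (x + s) ≤
        ENNReal.ofReal C * (∫⁻ x, u x ^ m) ^ (2 / m) := by
  have hm0 : 0 < m := by linarith
  have h2m : 0 < 2 / m - 1 := by rw [sub_pos, lt_div_iff₀ hm0]; linarith
  set c := 2 / (2 / m - 1) + 2 ^ (1 - 1 / m) with hc
  have hc0 : 0 < c := by positivity
  refine ⟨2 * c, by positivity, fun u hu hfin => ?_⟩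
  set J := ∫⁻ x, u x ^ m with hJ
  set a := 2 - 2 / m with ha
  rcases eq_or_ne J ⊤ with hJT | hJT
  · rw [hJT, ENNReal.top_rpow_of_pos (by positivity), ENNReal.mul_top
      (by simpa using hc0)]
    exact le_top
  rcases eq_or_ne J 0 with hJ0 | hJ0
  · have hu0 : u =ᵐ[volume] 0 := by
      rw [hJ, lintegral_eq_zero_iff (hu.pow_const m)] at hJ0
      filter_upwards [hJ0] with x hx
      simpa [hm0, not_lt.2 hm0.le] using hx
    have hz : ∀ s, ∫⁻ x, u x * u (x + s) = 0 := fun s => by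
      rw [lintegral_eq_zero_iff (by fun_prop)]
      filter_upwards [hu0] with x hx
      simp [hx]
    simp [hz]
  set w : ℝ → ℝ≥0∞ := fun s => ENNReal.ofReal (|s| ^ (-a)) with hw
  have hwm : Measurable w := by fun_prop
  set I := ∫⁻ x, u x * ∫⁻ s, w s * min (u (x + s)) (u x) with hI
  have hIle : I ≤ ENNReal.ofReal c * J ^ (2 / m) := by
    -- Truncation at height b = u(x) produces u(x)·u(x)^{m-1} = u(x)^m, whose integral is J; no
    -- weak-type bound is needed.
    have hx : ∀ x, u x * ∫⁻ s, w s * min (u (x + s)) (u x) ≤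
        ENNReal.ofReal c * J ^ (2 / m - 1) * u x ^ m := by
      intro x
      rcases eq_or_ne (u x) 0 with h0 | h0
      · simp [h0]
      have hsh : ∫⁻ s, u (x + s) ^ m = J :=
        lintegral_add_left_eq_self (fun s => u s ^ m) x
      have := lintegral_rpow_mul_min_le h1 h2 (v := fun s => u (x + s)) (by fun_prop) h0 (hfin x)
        (by rwa [hsh]) (by rwa [hsh])
      rw [hsh] at this
      refine (mul_le_mul_right this _).trans (le_of_eq ?_)
      have hum : u x ^ m = u x * u x ^ (m - 1) := by
        nth_rewrite 2 [← ENNReal.rpow_one (u x)]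
        rw [← ENNReal.rpow_add _ _ h0 (hfin x)]
        congr 1
        ring
      rw [hum]
      ring
    refine (lintegral_mono hx).trans (le_of_eq ?_)
    rw [lintegral_const_mul _ (hu.pow_const m), ← hJ, mul_assoc]
    congr 1
    nth_rewrite 2 [← ENNReal.rpow_one J]
    rw [← ENNReal.rpow_add _ _ hJ0 hJT]
    congr 1
    ring
  -- The product of two numbers is their maximum times their minimum, and the maximum is at most
  -- their sum.
  have hpt : ∀ s x, w s * (u x * u (x + s)) ≤
      w s * (u x * min (u (x + s)) (u x)) + w s * (u (x + s) * min (u (x + s)) (u x)) := by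
    intro s x
    rw [← mul_add]
    refine mul_le_mul_right ?_ _
    rcases le_total (u (x + s)) (u x) with h | h
    · rw [min_eq_left h]
      exact le_self_add
    · rw [min_eq_right h, mul_comm (u x) (u (x + s))]
      exact le_add_self
  have p1 : ∫⁻ s, ∫⁻ x, w s * (u x * min (u (x + s)) (u x)) = I := by
    rw [lintegral_lintegral_swap (by fun_prop)]
    refine lintegral_congr fun x => ?_
    rw [← lintegral_const_mul _ (by fun_prop)]
    exact lintegral_congr fun s => by ring
  -- The substitution s ↦ -s, x ↦ x + s exchanges u(x) and u(x+s) and fixes the even weight.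
  have p2 : ∫⁻ s, ∫⁻ x, w s * (u (x + s) * min (u (x + s)) (u x)) = I := by
    rw [← p1, ← lintegral_neg_eq_self (fun s => ∫⁻ x, w s * (u x * min (u (x + s)) (u x)))]
    refine lintegral_congr fun s => ?_
    rw [← lintegral_add_right_eq_self (fun x => w (-s) * (u x * min (u (x + -s)) (u x))) s]
    refine lintegral_congr fun x => ?_
    simp only [hw, abs_neg, add_neg_cancel_right]
    rw [min_comm]
  calc ∫⁻ s, w s * ∫⁻ x, u x * u (x + s)
      = ∫⁻ s, ∫⁻ x, w s * (u x * u (x + s)) :=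
        lintegral_congr fun s => (lintegral_const_mul _ (by fun_prop)).symm
    _ ≤ ∫⁻ s, ∫⁻ x, (w s * (u x * min (u (x + s)) (u x)) +
          w s * (u (x + s) * min (u (x + s)) (u x))) :=
        lintegral_mono fun s => lintegral_mono fun x => hpt s x
    _ = I + I := by
        rw [lintegral_congr fun s => lintegral_add_left (by fun_prop) _, lintegral_add_left, p1,
          p2]
        exact Measurable.lintegral_prod_right'
          (f := fun z : ℝ × ℝ => w z.1 * (u z.2 * min (u (z.2 + z.1)) (u z.2))) (by fun_prop)
    _ ≤ ENNReal.ofReal (2 * c) * J ^ (2 / m) := by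
        rw [← two_mul, ENNReal.ofReal_mul (by norm_num), ENNReal.ofReal_ofNat, mul_assoc]
        exact mul_le_mul_right hIle _

/-! ### The edge r = 2. -/

/-- Bounded measurable functions on the line. -/
def BoundedMeasurable (f : ℝ → ℂ) : Prop :=
  Measurable f ∧ ∃ M, ∀ x, ‖f x‖ ≤ M

/-- The trilinear estimate with decay `|λ|^{-1/4}`, for bounded measurable functions. -/
def TrilinearBound (S : ℝ × ℝ → ℝ) (φ : ℝ × ℝ → ℂ) (p q r : ℝ) : Prop :=
  ∃ C : ℝ, 0 < C ∧ ∀ lam : ℝ, lam ≠ 0 → ∀ f g h : ℝ → ℂ,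
    BoundedMeasurable f → BoundedMeasurable g → BoundedMeasurable h →
    ‖form lam S φ f g h‖ₑ ≤ ENNReal.ofReal (C * |lam| ^ (-(1 / 4) : ℝ)) *
      (eLpNorm f (ENNReal.ofReal p) volume * eLpNorm g (ENNReal.ofReal q) volume *
        eLpNorm h (ENNReal.ofReal r) volume)

theorem lintegral_sq_le_of_sq_le {X P Q : ℝ → ℝ≥0∞} (hP : Measurable P) (hQ : Measurable Q)
    (h : ∀ᵐ s, X s ^ 2 ≤ P s * Q s) :
    (∫⁻ s, X s) ^ 2 ≤ (∫⁻ s, P s) * ∫⁻ s, Q s := by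
  have hsq : ∀ x : ℝ≥0∞, (x ^ (1 / 2 : ℝ)) ^ 2 = x := fun x => by
    rw [← ENNReal.rpow_natCast, ← ENNReal.rpow_mul]
    norm_num
  have h1 : ∫⁻ s, X s ≤ ∫⁻ s, P s ^ (1 / 2 : ℝ) * Q s ^ (1 / 2 : ℝ) := by
    refine lintegral_mono_ae ?_
    filter_upwards [h] with s hs
    refine (ENNReal.pow_le_pow_left_iff two_ne_zero).1 (hs.trans (le_of_eq ?_))
    rw [mul_pow, hsq, hsq]
  refine (pow_le_pow_left' h1 2).trans ((lintegral_mul_sq_le (by fun_prop) (by fun_prop)).trans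
    (le_of_eq ?_))
  simp only [hsq]

theorem measurePreserving_shear :
    MeasurePreserving (fun z : ℝ × ℝ => (z.1, z.1 + z.2)) :=
  measurePreserving_prod_add volume volume

theorem measurableEmbedding_shear :
    MeasurableEmbedding (fun z : ℝ × ℝ => (z.1, z.1 + z.2)) :=
  (MeasurableEquiv.shearAddRight ℝ).measurableEmbedding

theorem lintegral_enorm_sq_rpow_eq {p : ℝ} (hp : 0 < p) (f : ℝ → ℂ) :
    (∫⁻ x, (‖f x‖ₑ ^ 2) ^ (p / 2)) ^ (2 / (p / 2)) = eLpNorm f (ENNReal.ofReal p) volume ^ 4 := by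
  rw [eLpNorm_eq_lintegral_rpow_enorm_toReal (by simpa using hp) (by simp),
    ENNReal.toReal_ofReal hp.le, ← ENNReal.rpow_natCast, ← ENNReal.rpow_mul]
  congr 1
  · refine lintegral_congr fun x => ?_
    rw [← ENNReal.rpow_natCast, ← ENNReal.rpow_mul]
    congr 1
    push_cast
    ring
  · push_cast
    ring

theorem lintegral_enorm_sq_pow_two_eq (h : ℝ → ℂ) :
    (∫⁻ x, ‖h x‖ₑ ^ 2) ^ 2 = eLpNorm h (ENNReal.ofReal 2) volume ^ 4 := by
  have := lintegral_enorm_sq_rpow_eq (p := 2) two_pos h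
  norm_num at this
  simpa using this

/-- TT* in t = x + y leaves an integral over shifts s. Hörmander's bound controls each shift, with
weight |s|^{-1/2}, and Hardy–Littlewood–Sobolev sums over s. The exponents p/2 and q/2 must lie in
(1,2), hence the open ranges. -/
theorem trilinearBound_of_third_eq_two {S : ℝ × ℝ → ℝ} (hS : ContDiff ℝ ∞ S)
    (hSc : HasCompactSupport S) {φ : ℝ × ℝ → ℂ} (hφ : ContDiff ℝ ∞ φ) (hφc : HasCompactSupport φ)
    (hD : ∀ z ∈ convexHull ℝ (tsupport φ), 1 ≤ |opD S z|) {p q : ℝ} (hp : p ∈ Set.Ioo (2 : ℝ) 4)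
    (hq : q ∈ Set.Ioo (2 : ℝ) 4) (hpq : 1 / p + 1 / q = 3 / 4) : TrilinearBound S φ p q 2 := by
  obtain ⟨C, hC0, hC⟩ := exists_enorm_integral_shiftKernel_sq_le hS hSc hφ hφc hD
  obtain ⟨R, hR0, hR⟩ := exists_tsupport_subset_box hφc
  obtain ⟨B, hB⟩ := hφc.exists_bound_of_continuous hφ.continuous
  have hB0 : 0 ≤ B := (norm_nonneg _).trans (hB 0)
  have hp0 : 0 < p := by linarith [hp.1]
  have hq0 : 0 < q := by linarith [hq.1]
  obtain ⟨Cp, hCp0, hCp⟩ := exists_lintegral_rpow_mul_lintegral_mul_shift_le (m := p / 2)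
    (by linarith [hp.1]) (by linarith [hp.2])
  obtain ⟨Cq, hCq0, hCq⟩ := exists_lintegral_rpow_mul_lintegral_mul_shift_le (m := q / 2)
    (by linarith [hq.1]) (by linarith [hq.2])
  -- `C` is only known to be nonnegative; adding 1 keeps the final constant positive.
  refine ⟨((C + 1) * Cp * Cq) ^ (1 / 4 : ℝ), by positivity, ?_⟩
  rintro lam hlam f g h ⟨hf, Mf, hMf⟩ ⟨hg, Mg, hMg⟩ ⟨hh, Mh, hMh⟩
  have hMf0 : 0 ≤ Mf := (norm_nonneg _).trans (hMf 0)
  have hMg0 : 0 ≤ Mg := (norm_nonneg _).trans (hMg 0)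
  set k : ℝ × ℝ → ℂ := fun w => Complex.exp (Complex.I * ((lam * S (w.1, w.2 - w.1) : ℝ) : ℂ)) *
    φ (w.1, w.2 - w.1) * f w.1 * g (w.2 - w.1) with hk
  have hSm := hS.continuous.measurable
  have hφm := hφ.continuous.measurable
  have hkm : Measurable k := by fun_prop
  have hkb : ∀ w, ‖k w‖ ≤ B * Mf * Mg := fun w => by
    simp only [hk, norm_mul, norm_exp_I_mul, one_mul]
    exact mul_le_mul (mul_le_mul (hB _) (hMf _) (norm_nonneg _) hB0) (hMg _) (norm_nonneg _)
      (by positivity)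
  have hks : ∀ w, k w ≠ 0 → w ∈ Set.Icc (-(2 * R)) (2 * R) ×ˢ Set.Icc (-(2 * R)) (2 * R) := by
    intro w hw
    have hφw : φ (w.1, w.2 - w.1) ≠ 0 := fun h0 => hw (by simp [hk, h0])
    obtain ⟨h1, h2⟩ := hR (subset_tsupport φ hφw)
    simp only [Set.mem_Icc, Set.mem_prod] at h1 h2 ⊢
    refine ⟨⟨?_, ?_⟩, ?_, ?_⟩ <;> linarith
  have hform : form lam S φ f g h = ∫ t, h t * ∫ x, k (x, t) := by
    have hi : Integrable (fun w : ℝ × ℝ => h w.2 * k w) (volume.prod volume) := by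
      refine integrable_of_bounded_of_support (by fun_prop) (M := Mh * (B * Mf * Mg)) (fun w => ?_)
        (volume_box_ne_top (2 * R)) (fun w hw => hks w (right_ne_zero_of_mul hw))
      rw [norm_mul]
      exact mul_le_mul (hMh _) (hkb _) (norm_nonneg _) ((norm_nonneg _).trans (hMh 0))
    have e := measurePreserving_shear.integral_comp measurableEmbedding_shear
      (fun w : ℝ × ℝ => h w.2 * k w)
    rw [form]
    simp only [← integral_const_mul]
    rw [← integral_prod_symm _ hi]
    refine Eq.trans ?_ e
    refine integral_congr_ae (Filter.Eventually.of_forall fun z => ?_)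
    simp only [integrand, hk, add_sub_cancel_left, Prod.mk.eta]
    ring
  -- Moving x by s with t = x + y fixed moves (x, y) by (s, -s); this is where `shiftKernel` arises.
  have hshift : ∀ s, ∫ w : ℝ × ℝ, k w * conj (k (w.1 + s, w.2)) =
      ∫ z : ℝ × ℝ, shiftKernel lam S φ s z * (f z.1 * conj (f (z.1 + s))) *
        (g z.2 * conj (g (z.2 - s))) := by
    intro s
    rw [← measurePreserving_shear.integral_comp measurableEmbedding_shear
      (fun w : ℝ × ℝ => k w * conj (k (w.1 + s, w.2)))]
    refine integral_congr_ae (Filter.Eventually.of_forall fun z => ?_)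
    simp only [shiftKernel, hk, map_mul, add_sub_cancel_left, add_sub_add_left_eq_sub, Prod.mk.eta]
    ring
  set u : ℝ → ℝ≥0∞ := fun x => ‖f x‖ₑ ^ 2 with hu
  set v : ℝ → ℝ≥0∞ := fun x => ‖g x‖ₑ ^ 2 with hv
  have hum : Measurable u := by fun_prop
  have hvm : Measurable v := by fun_prop
  set a := 2 - 2 / (p / 2) with ha
  set b := 2 - 2 / (q / 2) with hb
  have hab : a + b = 1 := by
    rw [ha, hb, show 2 / (p / 2) = 4 * (1 / p) by field_simp; norm_num,
      show 2 / (q / 2) = 4 * (1 / q) by field_simp; norm_num]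
    linarith
  have conj_enorm : ∀ c : ℂ, ‖conj c‖ₑ = ‖c‖ₑ := fun c => by
    rw [← ofReal_norm, RCLike.norm_conj, ofReal_norm]
  have hconjm : Measurable (fun z : ℂ => conj z) := Complex.continuous_conj.measurable
  have hX : ∀ s, s ≠ 0 → ‖∫ w : ℝ × ℝ, k w * conj (k (w.1 + s, w.2))‖ₑ ^ 2 ≤
      (ENNReal.ofReal ((C + 1) / |lam|) * (ENNReal.ofReal (|s| ^ (-a)) * ∫⁻ x, u x * u (x + s))) *
        (ENNReal.ofReal (|s| ^ (-b)) * ∫⁻ y, v y * v (y + s)) := by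
    intro s hs
    have hs0 : 0 < |s| := abs_pos.2 hs
    have hl0 : 0 < |lam| := abs_pos.2 hlam
    rw [hshift]
    have h1 := hC lam s hlam hs (fun x => f x * conj (f (x + s))) (fun y => g y * conj (g (y - s)))
      (by fun_prop) (by fun_prop)
      ⟨Mf * Mf, fun x => by
        rw [norm_mul, RCLike.norm_conj]
        exact mul_le_mul (hMf _) (hMf _) (norm_nonneg _) hMf0⟩
      ⟨Mg * Mg, fun x => by
        rw [norm_mul, RCLike.norm_conj]
        exact mul_le_mul (hMg _) (hMg _) (norm_nonneg _) hMg0⟩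
    refine h1.trans ?_
    have e1 : ∫⁻ x, ‖f x * conj (f (x + s))‖ₑ ^ 2 = ∫⁻ x, u x * u (x + s) :=
      lintegral_congr fun x => by rw [enorm_mul, conj_enorm, mul_pow]
    have e2 : ∫⁻ y, ‖g y * conj (g (y - s))‖ₑ ^ 2 = ∫⁻ y, v y * v (y + s) := by
      rw [← lintegral_add_right_eq_self _ s]
      exact lintegral_congr fun x => by
        rw [enorm_mul, conj_enorm, mul_pow, add_sub_cancel_right, mul_comm]
    rw [e1, e2]
    have e3 : ENNReal.ofReal (C / (|lam| * |s|)) ≤ ENNReal.ofReal ((C + 1) / |lam|) *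
        ENNReal.ofReal (|s| ^ (-a)) * ENNReal.ofReal (|s| ^ (-b)) := by
      rw [mul_assoc, ← ENNReal.ofReal_mul (by positivity), ← Real.rpow_add hs0,
        show -a + -b = -1 by linarith, Real.rpow_neg_one, ← ENNReal.ofReal_mul (by positivity)]
      refine ENNReal.ofReal_le_ofReal ?_
      rw [← div_div, div_eq_mul_inv (C / |lam|)]
      gcongr
      linarith
    refine (mul_le_mul_left (mul_le_mul_left e3 _) _).trans (le_of_eq ?_)
    ring
  have main := enorm_integral_mul_integral_sq_le hkm hkb hks hh.aemeasurable
  have hmeas : ∀ w : ℝ → ℝ≥0∞, Measurable w → Measurable fun s => ∫⁻ x, w x * w (x + s) :=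
    fun w hw => Measurable.lintegral_prod_right'
      (f := fun z : ℝ × ℝ => w z.2 * w (z.2 + z.1)) (by fun_prop)
  have hmu := hmeas u hum
  have hmv := hmeas v hvm
  have hae : ∀ᵐ s : ℝ, s ≠ 0 := by
    simp [ae_iff]
  have hXint := lintegral_sq_le_of_sq_le (by fun_prop) (by fun_prop) (hae.mono hX)
  rw [lintegral_const_mul _ (by fun_prop)] at hXint
  have hU := hCp u hum (fun x => by simp [hu])
  have hV := hCq v hvm (fun x => by simp [hv])
  -- Squaring for TT* and again for Cauchy–Schwarz in s gives a bound for the fourth power with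
  -- factor |λ|⁻¹, hence the decay |λ|^{-1/4}.
  have four : ‖form lam S φ f g h‖ₑ ^ 4 ≤ (ENNReal.ofReal (((C + 1) * Cp * Cq) ^ (1 / 4 : ℝ) *
      |lam| ^ (-(1 / 4) : ℝ)) * (eLpNorm f (ENNReal.ofReal p) volume *
        eLpNorm g (ENNReal.ofReal q) volume * eLpNorm h (ENNReal.ofReal 2) volume)) ^ 4 := by
    rw [hform, show (4 : ℕ) = 2 * 2 by norm_num, pow_mul]
    refine (pow_le_pow_left' main 2).trans ?_
    rw [mul_pow]
    refine (mul_le_mul_right (hXint.trans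
      (mul_le_mul' (mul_le_mul_right hU _) hV)) _).trans (le_of_eq ?_)
    rw [hu, hv, lintegral_enorm_sq_rpow_eq hp0, lintegral_enorm_sq_rpow_eq hq0,
      lintegral_enorm_sq_pow_two_eq]
    have e4 : ENNReal.ofReal (((C + 1) * Cp * Cq) ^ (1 / 4 : ℝ) * |lam| ^ (-(1 / 4) : ℝ)) ^ 4 =
        ENNReal.ofReal ((C + 1) / |lam|) * ENNReal.ofReal Cp * ENNReal.ofReal Cq := by
      rw [← ENNReal.ofReal_mul (by positivity), ← ENNReal.ofReal_mul (by positivity),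
        ← ENNReal.ofReal_pow (by positivity)]
      congr 1
      rw [mul_pow, ← Real.rpow_natCast, ← Real.rpow_natCast, ← Real.rpow_mul (by positivity),
        ← Real.rpow_mul (by positivity)]
      norm_num [Real.rpow_neg_one]
      ring
    rw [mul_pow, e4]
    ring
  exact (ENNReal.pow_le_pow_left_iff four_ne_zero).1 four

/-! ### Cyclic symmetry and the three edges. -/

/-- Globally defined smooth phases with compact support and smooth amplitudes, nondegenerate on
the convex hull of the support of the amplitude. -/
structure Admissible (S : ℝ × ℝ → ℝ) (φ : ℝ × ℝ → ℂ) : Prop where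
  phase_smooth : ContDiff ℝ ∞ S
  phase_compact : HasCompactSupport S
  amplitude_smooth : ContDiff ℝ ∞ φ
  amplitude_compact : HasCompactSupport φ
  one_le : ∀ z ∈ convexHull ℝ (tsupport φ), 1 ≤ |opD S z|

/-- The linear symmetry of the plane which permutes the three forms `x`, `y`, `x + y` cyclically,
up to sign. -/
noncomputable def rotation : (ℝ × ℝ) ≃L[ℝ] (ℝ × ℝ) :=
  LinearEquiv.toContinuousLinearEquiv
    { toFun := fun z => (z.1 + z.2, -z.1)
      invFun := fun z => (-z.2, z.1 + z.2)
      map_add' := fun z w => by ext <;> simp <;> ring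
      map_smul' := fun c z => by ext <;> simp; ring
      left_inv := fun z => by simp
      right_inv := fun z => by simp }

theorem rotation_apply (z : ℝ × ℝ) : rotation z = (z.1 + z.2, -z.1) := rfl

theorem measurePreserving_rotation : MeasurePreserving (rotation : ℝ × ℝ → ℝ × ℝ) := by
  have h1 : MeasurePreserving (Prod.swap : ℝ × ℝ → ℝ × ℝ) := Measure.measurePreserving_swap
  have h2 : MeasurePreserving (Prod.map id (fun x : ℝ => -x) : ℝ × ℝ → ℝ × ℝ) :=
    (MeasurePreserving.id volume).prod (Measure.measurePreserving_neg volume)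
  exact h2.comp (h1.comp measurePreserving_shear)

/-- D differentiates along (1,0), (0,1) and (1,-1). The map permutes these directions with a single
change of sign, and derivatives commute. -/
theorem opD_comp_rotation {S : ℝ × ℝ → ℝ} (hS : ContDiff ℝ ∞ S) (z : ℝ × ℝ) :
    opD (S ∘ rotation) z = -opD S (rotation z) := by
  have hc : ContDiff ℝ ∞ (S ∘ rotation) := hS.comp rotation.contDiff
  have hd : ∀ (v : ℝ × ℝ) {F : ℝ × ℝ → ℝ}, ContDiff ℝ ∞ F →
      dirDeriv v (F ∘ rotation) = dirDeriv (rotation v) F ∘ rotation := fun v _ hF =>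
    dirDeriv_comp_linear hF rotation.toContinuousLinearMap v
  have e1 : rotation (1, -1) = -(0, 1) := by simp [rotation_apply]
  have e2 : rotation (0, 1) = (1, 0) := by simp [rotation_apply]
  have e3 : rotation (1, 0) = (1, -1) := by simp [rotation_apply]
  have hS1 := contDiff_dirDeriv hS (0, 1)
  rw [opD_eq hc, hd _ hS, e1, dirDeriv_neg_dir, hd _ hS1.neg, e2, dirDeriv_neg_fun,
    hd _ (contDiff_dirDeriv hS1 _).neg, e3, dirDeriv_neg_fun, dirDeriv_comm hS (1, 0) (0, 1),
    opD_eq_of_partial_first hS]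
  rfl

theorem Admissible.comp_rotation {S : ℝ × ℝ → ℝ} {φ : ℝ × ℝ → ℂ} (h : Admissible S φ) :
    Admissible (S ∘ rotation) (φ ∘ rotation) where
  phase_smooth := h.phase_smooth.comp rotation.contDiff
  phase_compact := h.phase_compact.comp_homeomorph rotation.toHomeomorph
  amplitude_smooth := h.amplitude_smooth.comp rotation.contDiff
  amplitude_compact := h.amplitude_compact.comp_homeomorph rotation.toHomeomorph
  one_le := by
    intro z hz
    rw [opD_comp_rotation h.phase_smooth, abs_neg]
    refine h.one_le _ ?_
    have hconv : Convex ℝ (rotation ⁻¹' convexHull ℝ (tsupport φ)) :=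
      (convex_convexHull ℝ (tsupport φ)).linear_preimage rotation.toLinearEquiv.toLinearMap
    refine convexHull_min ?_ hconv hz
    intro w hw
    exact subset_convexHull ℝ _ (tsupport_comp_subset_preimage φ rotation.continuous hw)

theorem form_eq_form_comp_rotation (lam : ℝ) (S : ℝ × ℝ → ℝ) (φ : ℝ × ℝ → ℂ) (f g h : ℝ → ℂ) :
    form lam S φ f g h =
      form lam (S ∘ rotation) (φ ∘ rotation) (fun x => g (-x)) h f := by
  have e := measurePreserving_rotation.integral_comp
    rotation.toHomeomorph.measurableEmbedding (integrand lam S φ f g h)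
  rw [form, ← e, form]
  refine integral_congr_ae (Filter.Eventually.of_forall fun z => ?_)
  simp only [integrand, Function.comp_apply, rotation_apply,
    show z.1 + z.2 + -z.1 = z.2 by ring]
  ring

/-- The change of variables moves (f, g, h) to (g(-·), h, f), and reflection preserves the norm. -/
theorem TrilinearBound.of_comp_rotation {S : ℝ × ℝ → ℝ} {φ : ℝ × ℝ → ℂ} {p q r : ℝ}
    (h : TrilinearBound (S ∘ rotation) (φ ∘ rotation) p q r) : TrilinearBound S φ r p q := by
  obtain ⟨C, hC, hb⟩ := h
  refine ⟨C, hC, fun lam hlam f g h hf hg hh => ?_⟩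
  have hg' : BoundedMeasurable (fun x => g (-x)) :=
    ⟨hg.1.comp measurable_neg, hg.2.imp fun M hM x => hM _⟩
  have key := hb lam hlam _ _ _ hg' hh hf
  rw [← form_eq_form_comp_rotation] at key
  have e : eLpNorm (fun x => g (-x)) (ENNReal.ofReal p) volume =
      eLpNorm g (ENNReal.ofReal p) volume :=
    eLpNorm_comp_measurePreserving hg.1.aestronglyMeasurable
      (Measure.measurePreserving_neg volume)
  rw [e] at key
  refine key.trans (le_of_eq ?_)
  ring

theorem Admissible.trilinearBound_third {S : ℝ × ℝ → ℝ} {φ : ℝ × ℝ → ℂ} (h : Admissible S φ)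
    {p q : ℝ} (hp : p ∈ Set.Ioo (2 : ℝ) 4) (hq : q ∈ Set.Ioo (2 : ℝ) 4)
    (hpq : 1 / p + 1 / q = 3 / 4) : TrilinearBound S φ p q 2 :=
  trilinearBound_of_third_eq_two h.phase_smooth h.phase_compact h.amplitude_smooth
    h.amplitude_compact h.one_le hp hq hpq

theorem Admissible.trilinearBound_first {S : ℝ × ℝ → ℝ} {φ : ℝ × ℝ → ℂ} (h : Admissible S φ)
    {p q : ℝ} (hp : p ∈ Set.Ioo (2 : ℝ) 4) (hq : q ∈ Set.Ioo (2 : ℝ) 4)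
    (hpq : 1 / p + 1 / q = 3 / 4) : TrilinearBound S φ 2 p q :=
  (h.comp_rotation.trilinearBound_third hp hq hpq).of_comp_rotation

theorem Admissible.trilinearBound_second {S : ℝ × ℝ → ℝ} {φ : ℝ × ℝ → ℂ} (h : Admissible S φ)
    {p q : ℝ} (hp : p ∈ Set.Ioo (2 : ℝ) 4) (hq : q ∈ Set.Ioo (2 : ℝ) 4)
    (hpq : 1 / p + 1 / q = 3 / 4) : TrilinearBound S φ p 2 q :=
  (h.comp_rotation.trilinearBound_first hq hp (by linarith)).of_comp_rotation

/-! ### Complex interpolation on simple functions. -/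

/-- The complex power of the modulus of `a`, with the argument of `a` retained. -/
noncomputable def phasePow (w a : ℂ) : ℂ :=
  a / (‖a‖ : ℂ) * (‖a‖ : ℂ) ^ w

theorem norm_phasePow {w : ℂ} (hw : 0 < w.re) (a : ℂ) : ‖phasePow w a‖ = ‖a‖ ^ w.re := by
  rcases eq_or_ne a 0 with rfl | ha
  · simp [phasePow, Real.zero_rpow hw.ne']
  · have h := norm_pos_iff.2 ha
    rw [phasePow, norm_mul, norm_div, Complex.norm_real, norm_norm, div_self h.ne', one_mul,
      Complex.norm_cpow_eq_rpow_re_of_pos h]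

theorem phasePow_one (a : ℂ) : phasePow 1 a = a := by
  rcases eq_or_ne a 0 with rfl | ha
  · simp [phasePow]
  · have : (‖a‖ : ℂ) ≠ 0 := by simpa using ha
    rw [phasePow, Complex.cpow_one, div_mul_cancel₀ _ this]

/-- At a = 0 the factor a/‖a‖ is 0, so the function is identically zero, even at w = 0 where 0^0 =
1. -/
theorem differentiable_phasePow (a : ℂ) : Differentiable ℂ fun w => phasePow w a := by
  rcases eq_or_ne a 0 with rfl | ha
  · simp [phasePow]
  · have : (‖a‖ : ℂ) ≠ 0 := by simpa using ha
    exact (differentiable_id.const_cpow (Or.inl this)).const_mul _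

theorem eLpNorm_phasePow_comp {p p₀ : ℝ} (hp : 0 < p) (hp₀ : 0 < p₀) {w : ℂ}
    (hw : w.re = p / p₀) (g : ℝ → ℂ) :
    eLpNorm (phasePow w ∘ g) (ENNReal.ofReal p₀) volume =
      (∫⁻ x, ‖g x‖ₑ ^ p) ^ (1 / p₀) := by
  rw [eLpNorm_eq_lintegral_rpow_enorm_toReal (by simpa using hp₀) (by simp),
    ENNReal.toReal_ofReal hp₀.le]
  congr 1
  refine lintegral_congr fun x => ?_
  have hw0 : 0 < w.re := hw ▸ div_pos hp hp₀
  rw [Function.comp_apply, ← ofReal_norm, norm_phasePow hw0, ← ENNReal.ofReal_rpow_of_nonneg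
    (norm_nonneg _) hw0.le, ← ENNReal.rpow_mul, ofReal_norm, hw, div_mul_cancel₀ _ hp₀.ne']

/-- The affine family of exponents used in complex interpolation. -/
noncomputable def interpExponent (p p₀ p₁ : ℝ) (z : ℂ) : ℂ :=
  (p : ℂ) * ((1 - z) / (p₀ : ℂ) + z / (p₁ : ℂ))

theorem re_interpExponent (p p₀ p₁ : ℝ) (z : ℂ) :
    (interpExponent p p₀ p₁ z).re = p * ((1 - z.re) / p₀ + z.re / p₁) := by
  simp [interpExponent, Complex.div_ofReal_re]

theorem re_interpExponent_pos {p p₀ p₁ : ℝ} (hp : 0 < p) (hp₀ : 0 < p₀) (hp₁ : 0 < p₁) {z : ℂ}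
    (hz : z.re ∈ Set.Icc (0 : ℝ) 1) : 0 < (interpExponent p p₀ p₁ z).re := by
  rw [re_interpExponent]
  refine mul_pos hp ?_
  rcases hz.1.eq_or_lt with h | h
  · rw [← h]
    simpa using hp₀
  · exact add_pos_of_nonneg_of_pos (div_nonneg (by linarith [hz.2]) hp₀.le) (div_pos h hp₁)

theorem norm_phasePow_interpExponent_le {p p₀ p₁ : ℝ} (hp : 0 < p) (hp₀ : 0 < p₀) (hp₁ : 0 < p₁)
    {z : ℂ} (hz : z.re ∈ Set.Icc (0 : ℝ) 1) (a : ℂ) :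
    ‖phasePow (interpExponent p p₀ p₁ z) a‖ ≤ (1 + ‖a‖) ^ (p * (1 / p₀ + 1 / p₁)) := by
  rw [norm_phasePow (re_interpExponent_pos hp hp₀ hp₁ hz)]
  refine (Real.rpow_le_rpow (norm_nonneg a) (le_add_of_nonneg_left zero_le_one)
    (re_interpExponent_pos hp hp₀ hp₁ hz).le).trans ?_
  refine Real.rpow_le_rpow_of_exponent_le (by linarith [norm_nonneg a]) ?_
  rw [re_interpExponent]
  obtain ⟨h0, h1⟩ := hz
  gcongr
  linarith

/-- Complex interpolation for bilinear forms on simple functions. -/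
theorem enorm_le_of_interpolation {B : (ℝ → ℂ) → (ℝ → ℂ) → ℂ}
    -- The coefficients c do not depend on G and H, so the analytic family below is a finite sum of
    -- entire functions.
    (hB : ∀ g h : SimpleFunc ℝ ℂ, ∃ c : ℂ → ℂ → ℂ, ∀ G H : ℂ → ℂ,
      B (G ∘ g) (H ∘ h) = ∑ a ∈ g.range, ∑ b ∈ h.range, G a * H b * c a b)
    {p p₀ p₁ q q₀ q₁ θ : ℝ} (hp : 0 < p) (hp₀ : 0 < p₀) (hp₁ : 0 < p₁) (hq : 0 < q) (hq₀ : 0 < q₀)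
    (hq₁ : 0 < q₁) (hθ : θ ∈ Set.Icc (0 : ℝ) 1) (hpθ : 1 / p = (1 - θ) / p₀ + θ / p₁)
    (hqθ : 1 / q = (1 - θ) / q₀ + θ / q₁) {M : ℝ≥0∞} (hM : M ≠ ⊤)
    (h₀ : ∀ g h : SimpleFunc ℝ ℂ, ‖B g h‖ₑ ≤
      M * (eLpNorm g (ENNReal.ofReal p₀) volume * eLpNorm h (ENNReal.ofReal q₀) volume))
    (h₁ : ∀ g h : SimpleFunc ℝ ℂ, ‖B g h‖ₑ ≤
      M * (eLpNorm g (ENNReal.ofReal p₁) volume * eLpNorm h (ENNReal.ofReal q₁) volume))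
    (g h : SimpleFunc ℝ ℂ) (hg : eLpNorm g (ENNReal.ofReal p) volume ≠ ⊤)
    (hh : eLpNorm h (ENNReal.ofReal q) volume ≠ ⊤) :
    ‖B g h‖ₑ ≤
      M * (eLpNorm g (ENNReal.ofReal p) volume * eLpNorm h (ENNReal.ofReal q) volume) := by
  obtain ⟨c, hc⟩ := hB g h
  set J := ∫⁻ x, ‖g x‖ₑ ^ p with hJ
  set K := ∫⁻ x, ‖h x‖ₑ ^ q with hK
  have hgJ : eLpNorm g (ENNReal.ofReal p) volume = J ^ (1 / p) := by
    rw [eLpNorm_eq_lintegral_rpow_enorm_toReal (by simpa using hp) (by simp),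
      ENNReal.toReal_ofReal hp.le]
  have hhK : eLpNorm h (ENNReal.ofReal q) volume = K ^ (1 / q) := by
    rw [eLpNorm_eq_lintegral_rpow_enorm_toReal (by simpa using hq) (by simp),
      ENNReal.toReal_ofReal hq.le]
  have hJT : J ≠ ⊤ := fun hT => hg (by
    rw [hgJ, hT, ENNReal.top_rpow_of_pos (by positivity)])
  have hKT : K ≠ ⊤ := fun hT => hh (by
    rw [hhK, hT, ENNReal.top_rpow_of_pos (by positivity)])
  set F : ℂ → ℂ := fun z => B (phasePow (interpExponent p p₀ p₁ z) ∘ g)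
    (phasePow (interpExponent q q₀ q₁ z) ∘ h) with hF
  have hFsum : ∀ z, F z = ∑ a ∈ g.range, ∑ b ∈ h.range,
      phasePow (interpExponent p p₀ p₁ z) a * phasePow (interpExponent q q₀ q₁ z) b * c a b :=
    fun z => hc _ _
  have hexp : ∀ p p₀ p₁ : ℝ, Differentiable ℂ (interpExponent p p₀ p₁) := fun p p₀ p₁ => by
    unfold interpExponent
    fun_prop
  have hFd : Differentiable ℂ F := by
    have : F = fun z => ∑ a ∈ g.range, ∑ b ∈ h.range,
      phasePow (interpExponent p p₀ p₁ z) a * phasePow (interpExponent q q₀ q₁ z) b * c a b :=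
      funext hFsum
    rw [this]
    refine Differentiable.fun_sum fun a _ => Differentiable.fun_sum fun b _ => ?_
    exact (((differentiable_phasePow a).comp (hexp p p₀ p₁)).mul
      ((differentiable_phasePow b).comp (hexp q q₀ q₁))).mul_const _
  have hFb : BddAbove ((norm ∘ F) '' Complex.HadamardThreeLines.verticalClosedStrip 0 1) := by
    refine ⟨∑ a ∈ g.range, ∑ b ∈ h.range, (1 + ‖a‖) ^ (p * (1 / p₀ + 1 / p₁)) *
      (1 + ‖b‖) ^ (q * (1 / q₀ + 1 / q₁)) * ‖c a b‖, ?_⟩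
    rintro _ ⟨z, hz, rfl⟩
    have hz' : z.re ∈ Set.Icc (0 : ℝ) 1 := hz
    rw [Function.comp_apply, hFsum]
    refine (norm_sum_le _ _).trans (Finset.sum_le_sum fun a _ => (norm_sum_le _ _).trans
      (Finset.sum_le_sum fun b _ => ?_))
    rw [norm_mul, norm_mul]
    exact mul_le_mul_of_nonneg_right (mul_le_mul (norm_phasePow_interpExponent_le hp hp₀ hp₁ hz' a)
      (norm_phasePow_interpExponent_le hq hq₀ hq₁ hz' b) (norm_nonneg _) (by positivity))
      (norm_nonneg _)
  have edge : ∀ {p' q' : ℝ} {z : ℂ}, 0 < p' → 0 < q' →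
      (∀ g h : SimpleFunc ℝ ℂ, ‖B g h‖ₑ ≤
        M * (eLpNorm g (ENNReal.ofReal p') volume * eLpNorm h (ENNReal.ofReal q') volume)) →
      (interpExponent p p₀ p₁ z).re = p / p' → (interpExponent q q₀ q₁ z).re = q / q' →
      ‖F z‖ ≤ (M * (J ^ (1 / p') * K ^ (1 / q'))).toReal := by
    intro p' q' z hp' hq' hb e1 e2
    have := hb (g.map (phasePow (interpExponent p p₀ p₁ z)))
      (h.map (phasePow (interpExponent q q₀ q₁ z)))
    rw [SimpleFunc.coe_map, SimpleFunc.coe_map, eLpNorm_phasePow_comp hp hp' e1,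
      eLpNorm_phasePow_comp hq hq' e2] at this
    rw [← toReal_enorm]
    refine ENNReal.toReal_mono (ENNReal.mul_ne_top hM (ENNReal.mul_ne_top ?_ ?_)) this
    · exact ENNReal.rpow_ne_top_of_nonneg (by positivity) hJT
    · exact ENNReal.rpow_ne_top_of_nonneg (by positivity) hKT
  have fin : ∀ {p' q' : ℝ}, 0 < p' → 0 < q' → M * (J ^ (1 / p') * K ^ (1 / q')) ≠ ⊤ :=
    fun hp' hq' => ENNReal.mul_ne_top hM (ENNReal.mul_ne_top
      (ENNReal.rpow_ne_top_of_nonneg (by positivity) hJT)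
      (ENNReal.rpow_ne_top_of_nonneg (by positivity) hKT))
  -- On the lines Re z = 0 and Re z = 1 the norms of the family depend only on J and K; at z = θ
  -- both exponents are 1 and the family returns `B g h`.
  have three := Complex.HadamardThreeLines.norm_le_interp_of_mem_verticalClosedStrip₀₁' F
    (z := (θ : ℂ)) (a := (M * (J ^ (1 / p₀) * K ^ (1 / q₀))).toReal)
    (b := (M * (J ^ (1 / p₁) * K ^ (1 / q₁))).toReal) 
    (by simpa [Complex.HadamardThreeLines.verticalClosedStrip] using hθ)
    hFd.diffContOnCl hFb
    (fun z hz => by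
      have hz0 : z.re = 0 := hz
      refine edge hp₀ hq₀ h₀ ?_ ?_ <;> rw [re_interpExponent, hz0] <;> ring)
    (fun z hz => by
      have hz0 : z.re = 1 := hz
      refine edge hp₁ hq₁ h₁ ?_ ?_ <;> rw [re_interpExponent, hz0] <;> ring)
  have hone : ∀ {p p₀ p₁ : ℝ}, 0 < p → 1 / p = (1 - θ) / p₀ + θ / p₁ →
      interpExponent p p₀ p₁ (θ : ℂ) = 1 := by
    intro p p₀ p₁ hp h
    have : interpExponent p p₀ p₁ (θ : ℂ) = ((p * ((1 - θ) / p₀ + θ / p₁) : ℝ) : ℂ) := by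
      simp [interpExponent]
    rw [this, ← h, mul_one_div_cancel hp.ne', Complex.ofReal_one]
  have hFθ : F θ = B g h := by
    have e : phasePow 1 = id := funext phasePow_one
    simp only [hF, hone hp hpθ, hone hq hqθ, e, Function.id_comp]
  rw [hFθ, Complex.ofReal_re] at three
  have hθ1 : 0 ≤ 1 - θ := by linarith [hθ.2]
  calc ‖B g h‖ₑ = ENNReal.ofReal ‖B g h‖ := (ofReal_norm _).symm
    _ ≤ ENNReal.ofReal ((M * (J ^ (1 / p₀) * K ^ (1 / q₀))).toReal ^ (1 - θ) *
          (M * (J ^ (1 / p₁) * K ^ (1 / q₁))).toReal ^ θ) := ENNReal.ofReal_le_ofReal three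
    _ = (M * (J ^ (1 / p₀) * K ^ (1 / q₀))) ^ (1 - θ) *
          (M * (J ^ (1 / p₁) * K ^ (1 / q₁))) ^ θ := by
        rw [ENNReal.ofReal_mul (by positivity),
          ← ENNReal.ofReal_rpow_of_nonneg ENNReal.toReal_nonneg hθ1,
          ← ENNReal.ofReal_rpow_of_nonneg ENNReal.toReal_nonneg hθ.1,
          ENNReal.ofReal_toReal (fin hp₀ hq₀), ENNReal.ofReal_toReal (fin hp₁ hq₁)]
    _ = M ^ ((1 - θ) + θ) * (J ^ ((1 - θ) / p₀ + θ / p₁) * K ^ ((1 - θ) / q₀ + θ / q₁)) := by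
        rw [ENNReal.rpow_add_of_nonneg _ _ hθ1 hθ.1,
          ENNReal.rpow_add_of_nonneg _ _ (div_nonneg hθ1 hp₀.le) (div_nonneg hθ.1 hp₁.le),
          ENNReal.rpow_add_of_nonneg _ _ (div_nonneg hθ1 hq₀.le) (div_nonneg hθ.1 hq₁.le)]
        simp only [ENNReal.mul_rpow_of_nonneg _ _ hθ1, ENNReal.mul_rpow_of_nonneg _ _ hθ.1,
          ← ENNReal.rpow_mul, one_div_mul_eq_div]
        ring
    _ = _ := by
        rw [← hpθ, ← hqθ, sub_add_cancel, ENNReal.rpow_one, hgJ, hhK]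

open scoped Topology

/-! ### Absolute convergence of the trilinear integral. -/

theorem norm_integrand (lam : ℝ) (S : ℝ × ℝ → ℝ) (φ : ℝ × ℝ → ℂ) (f g h : ℝ → ℂ) (z : ℝ × ℝ) :
    ‖integrand lam S φ f g h z‖ = ‖f z.1‖ * ‖g z.2‖ * ‖h (z.1 + z.2)‖ * ‖φ z‖ := by
  simp only [integrand, norm_mul, norm_exp_I_mul, one_mul]

theorem BoundedMeasurable.of_simpleFunc (g : SimpleFunc ℝ ℂ) : BoundedMeasurable g :=
  ⟨g.measurable, g.exists_forall_norm_le⟩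

theorem measurable_integrand {S : ℝ × ℝ → ℝ} (hS : Continuous S) {φ : ℝ × ℝ → ℂ}
    (hφ : Continuous φ) (lam : ℝ) {f g h : ℝ → ℂ} (hf : Measurable f) (hg : Measurable g)
    (hh : Measurable h) : Measurable (integrand lam S φ f g h) := by
  have hSm := hS.measurable
  have hφm := hφ.measurable
  unfold integrand
  fun_prop

theorem integrable_sq_indicator {r : ℝ} (hr : 2 ≤ r) {h : ℝ → ℂ}
    (hh : MemLp h (ENNReal.ofReal r) volume) (R : ℝ) :
    Integrable ((Set.Icc (-R) R).indicator fun x => ‖h x‖ ^ 2) := by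
  rw [integrable_indicator_iff measurableSet_Icc]
  have : MemLp h 2 (volume.restrict (Set.Icc (-R) R)) :=
    (hh.restrict _).mono_exponent (by
      rw [← ENNReal.ofReal_ofNat]
      exact ENNReal.ofReal_le_ofReal hr)
  exact (memLp_two_iff_integrable_sq_norm this.1).1 this

theorem integrable_norm_indicator {r : ℝ} (hr : 2 ≤ r) {h : ℝ → ℂ}
    (hh : MemLp h (ENNReal.ofReal r) volume) (R : ℝ) :
    Integrable ((Set.Icc (-R) R).indicator fun x => ‖h x‖) := by
  rw [integrable_indicator_iff measurableSet_Icc]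
  have : MemLp h 1 (volume.restrict (Set.Icc (-R) R)) :=
    (hh.restrict _).mono_exponent (by
      rw [← ENNReal.ofReal_one]
      exact ENNReal.ofReal_le_ofReal (by linarith))
  exact (memLp_one_iff_integrable.1 this).norm

/-- Absolute convergence of the integral which defines the trilinear form. -/
theorem integrable_integrand {S : ℝ × ℝ → ℝ} (hS : Continuous S) {φ : ℝ × ℝ → ℂ}
    (hφ : Continuous φ) (hφc : HasCompactSupport φ) (lam : ℝ) {p q r : ℝ} (hp : 2 ≤ p)
    (hq : 2 ≤ q) (hr : 2 ≤ r) {f g h : ℝ → ℂ} (fm : Measurable f) (gm : Measurable g)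
    (hm : Measurable h) (hf : MemLp f (ENNReal.ofReal p) volume)
    (hg : MemLp g (ENNReal.ofReal q) volume) (hh : MemLp h (ENNReal.ofReal r) volume) :
    Integrable (integrand lam S φ f g h) := by
  obtain ⟨R, hR0, hR⟩ := exists_tsupport_subset_box hφc
  obtain ⟨B, hB⟩ := hφc.exists_bound_of_continuous hφ
  have hB0 : 0 ≤ B := (norm_nonneg _).trans (hB 0)
  -- By |g||h| ≤ |g|² + |h|² the integrand is dominated by products of two locally integrable
  -- factors, in the variables (x, y) and (x, x + y) respectively.
  set f' := (Set.Icc (-R) R).indicator fun x => ‖f x‖ with hf'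
  set g' := (Set.Icc (-R) R).indicator fun x => ‖g x‖ ^ 2 with hg'
  set h' := (Set.Icc (-(2 * R)) (2 * R)).indicator fun x => ‖h x‖ ^ 2 with hh'
  have i1 : Integrable (fun z : ℝ × ℝ => f' z.1 * g' z.2) :=
    (integrable_norm_indicator hp hf R).mul_prod (integrable_sq_indicator hq hg R)
  have i2 : Integrable (fun z : ℝ × ℝ => f' z.1 * h' (z.1 + z.2)) := by
    have i3 : Integrable (fun z : ℝ × ℝ => f' z.1 * h' z.2) :=
      (integrable_norm_indicator hp hf R).mul_prod (integrable_sq_indicator hr hh (2 * R))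
    exact (measurePreserving_shear.integrable_comp_emb measurableEmbedding_shear).2 i3
  refine ((i1.add i2).const_mul B).mono'
    (measurable_integrand hS hφ lam fm gm hm).aestronglyMeasurable
    (Filter.Eventually.of_forall fun z => ?_)
  rw [norm_integrand]
  by_cases hz : φ z = 0
  · rw [hz, norm_zero, mul_zero]
    have n1 : ∀ x, 0 ≤ f' x := fun x => Set.indicator_nonneg (fun _ _ => norm_nonneg _) _
    have n2 : ∀ x, 0 ≤ g' x := fun x => Set.indicator_nonneg (fun _ _ => by positivity) _
    have n3 : ∀ x, 0 ≤ h' x := fun x => Set.indicator_nonneg (fun _ _ => by positivity) _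
    exact mul_nonneg hB0 (add_nonneg (mul_nonneg (n1 _) (n2 _)) (mul_nonneg (n1 _) (n3 _)))
  obtain ⟨hz1, hz2⟩ := hR (subset_tsupport φ hz)
  have hz3 : z.1 + z.2 ∈ Set.Icc (-(2 * R)) (2 * R) := by
    rw [Set.mem_Icc] at hz1 hz2 ⊢
    constructor <;> linarith
  simp only [Pi.add_apply, hf', hg', hh', Set.indicator_of_mem hz1, Set.indicator_of_mem hz2,
    Set.indicator_of_mem hz3]
  rw [← mul_add, mul_comm B, mul_assoc ‖f z.1‖]
  refine mul_le_mul (mul_le_mul_of_nonneg_left ?_ (norm_nonneg _)) (hB z) (norm_nonneg _)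
    (by positivity)
  nlinarith [sq_nonneg (‖g z.2‖ - ‖h (z.1 + z.2)‖), sq_nonneg ‖g z.2‖,
    sq_nonneg ‖h (z.1 + z.2)‖]

theorem integrable_integrand_of_bounded {S : ℝ × ℝ → ℝ} (hS : Continuous S) {φ : ℝ × ℝ → ℂ}
    (hφ : Continuous φ) (hφc : HasCompactSupport φ) (lam : ℝ) {f g h : ℝ → ℂ}
    (hf : BoundedMeasurable f) (hg : BoundedMeasurable g) (hh : BoundedMeasurable h) :
    Integrable (integrand lam S φ f g h) := by
  obtain ⟨B, hB⟩ := hφc.exists_bound_of_continuous hφ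
  obtain ⟨hf, Mf, hMf⟩ := hf
  obtain ⟨hg, Mg, hMg⟩ := hg
  obtain ⟨hh, Mh, hMh⟩ := hh
  have n1 := (norm_nonneg _).trans (hMf 0)
  have n2 := (norm_nonneg _).trans (hMg 0)
  have n3 := (norm_nonneg _).trans (hMh 0)
  refine integrable_of_bounded_of_support (measurable_integrand hS hφ lam hf hg hh)
    (M := Mf * Mg * Mh * B) (fun z => ?_) (s := tsupport φ) hφc.measure_lt_top.ne
    (fun z hz => subset_tsupport φ (right_ne_zero_of_mul hz))
  rw [norm_integrand]
  have := hMf z.1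
  have := hMg z.2
  have := hMh (z.1 + z.2)
  have := hB z
  gcongr

/-! ### Interior exponents for simple functions. -/

theorem simpleFunc_comp_eq_sum (g : SimpleFunc ℝ ℂ) (G : ℂ → ℂ) (x : ℝ) :
    G (g x) = ∑ a ∈ g.range, G a * (g ⁻¹' {a}).indicator 1 x := by
  rw [Finset.sum_eq_single (g x)]
  · simp
  · intro b _ hb
    rw [Set.indicator_of_notMem (by simpa using hb.symm), mul_zero]
  · intro h
    exact absurd (g.mem_range_self x) h

/-- Supplies the expansion that the interpolation theorem requires: the coefficients are values of
the form on indicators of level sets. -/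
theorem form_comp_simpleFunc {S : ℝ × ℝ → ℝ} (hS : Continuous S) {φ : ℝ × ℝ → ℂ}
    (hφ : Continuous φ) (hφc : HasCompactSupport φ) (lam : ℝ) {f : ℝ → ℂ}
    (hf : BoundedMeasurable f) (g h : SimpleFunc ℝ ℂ) (G H : ℂ → ℂ) :
    form lam S φ f (G ∘ g) (H ∘ h) = ∑ a ∈ g.range, ∑ b ∈ h.range, G a * H b *
      form lam S φ f ((g ⁻¹' {a}).indicator 1) ((h ⁻¹' {b}).indicator 1) := by
  have hb : ∀ (g : SimpleFunc ℝ ℂ) (a : ℂ), BoundedMeasurable ((g ⁻¹' {a}).indicator 1) :=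
    fun g a => ⟨measurable_const.indicator (g.measurableSet_fiber a), 1, fun x => by
      by_cases hx : x ∈ g ⁻¹' {a}
      · simp [Set.indicator_of_mem hx]
      · simp [Set.indicator_of_notMem hx]⟩
  have hi : ∀ a b, Integrable (integrand lam S φ f ((g ⁻¹' {a}).indicator 1)
      ((h ⁻¹' {b}).indicator 1)) := fun a b =>
    integrable_integrand_of_bounded hS hφ hφc lam hf (hb g a) (hb h b)
  simp only [form, ← integral_const_mul]
  rw [show (∑ a ∈ g.range, ∑ b ∈ h.range, ∫ z, G a * H b * integrand lam S φ f
      ((g ⁻¹' {a}).indicator 1) ((h ⁻¹' {b}).indicator 1) z) =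
      ∑ a ∈ g.range, ∫ z, ∑ b ∈ h.range, G a * H b * integrand lam S φ f
      ((g ⁻¹' {a}).indicator 1) ((h ⁻¹' {b}).indicator 1) z from
      Finset.sum_congr rfl fun a _ =>
        (integral_finsetSum _ fun b _ => (hi a b).const_mul _).symm,
    ← integral_finsetSum _ fun a _ => integrable_finsetSum _ fun b _ => (hi a b).const_mul _]
  refine integral_congr_ae (Filter.Eventually.of_forall fun z => ?_)
  simp only [integrand, Function.comp_apply]
  rw [simpleFunc_comp_eq_sum g G, simpleFunc_comp_eq_sum h H]
  simp only [Finset.mul_sum, Finset.sum_mul]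
  rw [Finset.sum_comm]
  exact Finset.sum_congr rfl fun a _ => Finset.sum_congr rfl fun b _ => by ring

/-- The trilinear estimate for simple functions in the full range of exponents. -/
theorem Admissible.exists_enorm_form_le {S : ℝ × ℝ → ℝ} {φ : ℝ × ℝ → ℂ} (hA : Admissible S φ)
    {p q r : ℝ} (he : (p, q, r) ∈ exponents) :
    ∃ C : ℝ, 0 < C ∧ ∀ lam : ℝ, lam ≠ 0 → ∀ f g h : SimpleFunc ℝ ℂ,
      eLpNorm f (ENNReal.ofReal p) volume ≠ ⊤ → eLpNorm g (ENNReal.ofReal q) volume ≠ ⊤ →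
      eLpNorm h (ENNReal.ofReal r) volume ≠ ⊤ →
      ‖form lam S φ f g h‖ₑ ≤ ENNReal.ofReal (C * |lam| ^ (-(1 / 4) : ℝ)) *
        (eLpNorm f (ENNReal.ofReal p) volume * eLpNorm g (ENNReal.ofReal q) volume *
          eLpNorm h (ENNReal.ofReal r) volume) := by
  have of_bound : TrilinearBound S φ p q r → ∃ C : ℝ, 0 < C ∧ ∀ lam : ℝ, lam ≠ 0 →
      ∀ f g h : SimpleFunc ℝ ℂ,
      eLpNorm f (ENNReal.ofReal p) volume ≠ ⊤ → eLpNorm g (ENNReal.ofReal q) volume ≠ ⊤ →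
      eLpNorm h (ENNReal.ofReal r) volume ≠ ⊤ →
      ‖form lam S φ f g h‖ₑ ≤ ENNReal.ofReal (C * |lam| ^ (-(1 / 4) : ℝ)) *
        (eLpNorm f (ENNReal.ofReal p) volume * eLpNorm g (ENNReal.ofReal q) volume *
          eLpNorm h (ENNReal.ofReal r) volume) := fun ⟨C, hC, hb⟩ =>
    ⟨C, hC, fun lam hlam f g h _ _ _ => hb lam hlam f g h (.of_simpleFunc f) (.of_simpleFunc g)
      (.of_simpleFunc h)⟩
  obtain ⟨⟨hp2, hp4⟩, ⟨hq2, hq4⟩, ⟨hr2, hr4⟩, hsum⟩ := he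
  simp only at hp2 hp4 hq2 hq4 hr2 hr4 hsum
  have quarter : ∀ {t : ℝ}, 2 ≤ t → t < 4 → 1 / 4 < 1 / t := fun h1 h2 =>
    one_div_lt_one_div_of_lt (by linarith) h2
  have half : ∀ {t : ℝ}, 2 < t → 1 / t < 1 / 2 := fun h => one_div_lt_one_div_of_lt (by norm_num) h
  have two_lt : ∀ {t : ℝ}, 2 ≤ t → 1 / t < 1 / 2 → 2 < t := fun h1 h2 =>
    (one_div_lt_one_div (by linarith) (by norm_num)).1 h2
  have p4 := quarter hp2 hp4
  have q4 := quarter hq2 hq4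
  have r4 := quarter hr2 hr4
  rcases hp2.eq_or_lt with rfl | hp2'
  · exact of_bound (hA.trilinearBound_first ⟨two_lt hq2 (by linarith), hq4⟩
      ⟨two_lt hr2 (by linarith), hr4⟩ (by linarith))
  rcases hq2.eq_or_lt with rfl | hq2'
  · exact of_bound (hA.trilinearBound_second ⟨two_lt hp2 (by linarith), hp4⟩
      ⟨two_lt hr2 (by linarith), hr4⟩ (by linarith))
  rcases hr2.eq_or_lt with rfl | hr2'
  · exact of_bound (hA.trilinearBound_third ⟨two_lt hp2 (by linarith), hp4⟩
      ⟨two_lt hq2 (by linarith), hq4⟩ (by linarith))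
  have p2 := half hp2'
  have q2 := half hq2'
  have r2 := half hr2'
  -- With p fixed, the horizontal segment through (1/q, 1/r) meets the two edges at (1/2, σ) and (σ,
  -- 1/2), since 1/q + 1/r = 1/2 + σ.
  set σ := 3 / 4 - 1 / p with hσ
  have hσ4 : 1 / 4 < σ := by linarith
  have hσ2 : σ < 1 / 2 := by linarith
  have hσ0 : 0 < σ := by linarith
  have hs : σ⁻¹ ∈ Set.Ioo (2 : ℝ) 4 := by
    constructor
    · rw [lt_inv_comm₀ (by norm_num) hσ0]; linarith
    · rw [inv_lt_comm₀ hσ0 (by norm_num)]; linarith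
  have hs1 : 1 / σ⁻¹ = σ := by rw [one_div, inv_inv]
  have hps : 1 / p + 1 / σ⁻¹ = 3 / 4 := by rw [hs1, hσ]; ring
  obtain ⟨C₀, hC₀, hb₀⟩ := hA.trilinearBound_second ⟨hp2', hp4⟩ hs hps
  obtain ⟨C₁, hC₁, hb₁⟩ := hA.trilinearBound_third ⟨hp2', hp4⟩ hs hps
  refine ⟨max C₀ C₁, lt_max_of_lt_left hC₀, fun lam hlam f g h hf hg hh => ?_⟩
  set θ := (1 / 2 - 1 / q) / (1 / 2 - σ) with hθ
  have hden : 0 < 1 / 2 - σ := by linarith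
  have hθm : θ * (1 / 2 - σ) = 1 / 2 - 1 / q := div_mul_cancel₀ _ hden.ne'
  have hθI : θ ∈ Set.Icc (0 : ℝ) 1 :=
    ⟨div_nonneg (by linarith) hden.le, (div_le_one hden).2 (by linarith)⟩
  have hqθ : 1 / q = (1 - θ) / 2 + θ / σ⁻¹ := by
    rw [div_inv_eq_mul]; linarith
  have hrθ : 1 / r = (1 - θ) / σ⁻¹ + θ / 2 := by
    rw [div_inv_eq_mul]; linarith
  have hl : 0 ≤ |lam| ^ (-(1 / 4) : ℝ) := by positivity
  have key := enorm_le_of_interpolation (B := fun g h => form lam S φ f g h)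
    -- The norm of the fixed function `f` is absorbed into the bound for the bilinear form.
    (M := ENNReal.ofReal (max C₀ C₁ * |lam| ^ (-(1 / 4) : ℝ)) *
      eLpNorm f (ENNReal.ofReal p) volume)
    (fun g h => ⟨_, fun G H => form_comp_simpleFunc hA.phase_smooth.continuous
      hA.amplitude_smooth.continuous hA.amplitude_compact lam (.of_simpleFunc f) g h G H⟩)
    (p := q) (q := r) (by linarith) two_pos (inv_pos.2 hσ0) (by linarith) (inv_pos.2 hσ0) two_pos
    hθI hqθ hrθ (ENNReal.mul_ne_top ENNReal.ofReal_ne_top hf)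
    (fun g h => (hb₀ lam hlam f g h (.of_simpleFunc f) (.of_simpleFunc g)
      (.of_simpleFunc h)).trans (by
        rw [mul_assoc, mul_assoc]
        exact mul_le_mul_left (ENNReal.ofReal_le_ofReal
          (mul_le_mul_of_nonneg_right (le_max_left _ _) hl)) _))
    (fun g h => (hb₁ lam hlam f g h (.of_simpleFunc f) (.of_simpleFunc g)
      (.of_simpleFunc h)).trans (by
        rw [mul_assoc, mul_assoc]
        exact mul_le_mul_left (ENNReal.ofReal_le_ofReal
          (mul_le_mul_of_nonneg_right (le_max_right _ _) hl)) _))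
    g h hg hh
  refine key.trans (le_of_eq ?_)
  ring

/-! ### Extension from simple functions to Lebesgue spaces. -/

open Filter

theorem integrand_congr_ae {f f' g g' h h' : ℝ → ℂ} (lam : ℝ) (S : ℝ × ℝ → ℝ) (φ : ℝ × ℝ → ℂ)
    (hf : f =ᵐ[volume] f') (hg : g =ᵐ[volume] g') (hh : h =ᵐ[volume] h') :
    integrand lam S φ f g h =ᵐ[volume] integrand lam S φ f' g' h' := by
  have q1 : Measure.QuasiMeasurePreserving (Prod.fst : ℝ × ℝ → ℝ) volume volume :=
    Measure.quasiMeasurePreserving_fst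
  have q2 : Measure.QuasiMeasurePreserving (Prod.snd : ℝ × ℝ → ℝ) volume volume :=
    Measure.quasiMeasurePreserving_snd
  have q3 := q2.comp measurePreserving_shear.quasiMeasurePreserving
  filter_upwards [q1.ae_eq_comp hf, q2.ae_eq_comp hg, q3.ae_eq_comp hh] with z h1 h2 h3
  simp only [Function.comp_apply] at h1 h2 h3
  simp only [integrand, h1, h2, h3]

/-- A bound for the trilinear form on simple functions extends to all of `L^p × L^q × L^r`. -/
theorem enorm_form_le_of_simpleFunc {S : ℝ × ℝ → ℝ} (hS : Continuous S) {φ : ℝ × ℝ → ℂ}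
    (hφ : Continuous φ) (hφc : HasCompactSupport φ) (lam : ℝ) {p q r : ℝ} (hp : 2 ≤ p)
    (hq : 2 ≤ q) (hr : 2 ≤ r) {M : ℝ≥0∞} (hM : M ≠ ⊤)
    (H : ∀ f g h : SimpleFunc ℝ ℂ, eLpNorm f (ENNReal.ofReal p) volume ≠ ⊤ →
      eLpNorm g (ENNReal.ofReal q) volume ≠ ⊤ → eLpNorm h (ENNReal.ofReal r) volume ≠ ⊤ →
      ‖form lam S φ f g h‖ₑ ≤ M * (eLpNorm f (ENNReal.ofReal p) volume *
        eLpNorm g (ENNReal.ofReal q) volume * eLpNorm h (ENNReal.ofReal r) volume))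
    {f g h : ℝ → ℂ} (fm : Measurable f) (gm : Measurable g) (hm : Measurable h)
    (hf : MemLp f (ENNReal.ofReal p) volume) (hg : MemLp g (ENNReal.ofReal q) volume)
    (hh : MemLp h (ENNReal.ofReal r) volume) :
    ‖form lam S φ f g h‖ₑ ≤ M * (eLpNorm f (ENNReal.ofReal p) volume *
        eLpNorm g (ENNReal.ofReal q) volume * eLpNorm h (ENNReal.ofReal r) volume) := by
  have approx : ∀ {t : ℝ} {f : ℝ → ℂ}, 2 ≤ t → Measurable f →
      MemLp f (ENNReal.ofReal t) volume → ∃ F : ℕ → SimpleFunc ℝ ℂ, ∃ N : ℕ → ℝ≥0∞,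
        (∀ x, Tendsto (fun n => F n x) atTop (𝓝 (f x))) ∧ (∀ n x, ‖F n x‖ ≤ 2 * ‖f x‖) ∧
        (∀ n, eLpNorm (F n) (ENNReal.ofReal t) volume ≤ N n) ∧
        (∀ n, eLpNorm (F n) (ENNReal.ofReal t) volume ≠ ⊤) ∧
        Tendsto N atTop (𝓝 (eLpNorm f (ENNReal.ofReal t) volume)) := by
    intro t f ht fm hf
    set F := fun n => SimpleFunc.approxOn f fm (Set.range f ∪ {0}) 0 (by simp) n with hF
    have hFm : ∀ n, MemLp (F n) (ENNReal.ofReal t) volume := fun n =>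
      SimpleFunc.memLp_approxOn_range fm hf n
    have hd := SimpleFunc.tendsto_approxOn_range_Lp_eLpNorm (μ := volume)
      (p := ENNReal.ofReal t) (by simp) fm hf.2
    -- By the triangle inequality this majorant bounds the norm of `F n`, and it tends to the norm
    -- of `f`.
    refine ⟨F, fun n => eLpNorm (⇑(F n) - f) (ENNReal.ofReal t) volume +
      eLpNorm f (ENNReal.ofReal t) volume, fun x => ?_, fun n x => ?_, fun n => ?_,
      fun n => (hFm n).2.ne, ?_⟩
    · exact SimpleFunc.tendsto_approxOn fm _ (subset_closure (by simp))
    · rw [two_mul]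
      exact SimpleFunc.norm_approxOn_zero_le fm _ x n
    · have h1 : 1 ≤ ENNReal.ofReal t := by
        rw [← ENNReal.ofReal_one]
        exact ENNReal.ofReal_le_ofReal (by linarith)
      have := eLpNorm_add_le ((hFm n).1.sub hf.1) hf.1 h1
      rwa [sub_add_cancel] at this
    · have := hd.add_const (eLpNorm f (ENNReal.ofReal t) volume)
      rwa [zero_add] at this
  obtain ⟨F, NF, F1, F2, F3, F4, F5⟩ := approx hp fm hf
  obtain ⟨G, NG, G1, G2, G3, G4, G5⟩ := approx hq gm hg
  obtain ⟨K, NK, K1, K2, K3, K4, K5⟩ := approx hr hm hh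
  have hlim : Tendsto (fun n => form lam S φ (F n) (G n) (K n)) atTop
      (𝓝 (form lam S φ f g h)) := by
    -- The constant 8 is 2³: each approximant is at most twice its limit in modulus.
    refine tendsto_integral_of_dominated_convergence (fun z => 8 * ‖integrand lam S φ f g h z‖)
      (fun n => (measurable_integrand hS hφ lam (F n).measurable (G n).measurable
        (K n).measurable).aestronglyMeasurable)
      ((integrable_integrand hS hφ hφc lam hp hq hr fm gm hm hf hg hh).norm.const_mul 8)
      (fun n => Eventually.of_forall fun z => ?_) (Eventually.of_forall fun z => ?_)
    · rw [norm_integrand, norm_integrand]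
      calc ‖F n z.1‖ * ‖G n z.2‖ * ‖K n (z.1 + z.2)‖ * ‖φ z‖
          ≤ (2 * ‖f z.1‖) * (2 * ‖g z.2‖) * (2 * ‖h (z.1 + z.2)‖) * ‖φ z‖ := by
            gcongr
            exacts [F2 n _, G2 n _, K2 n _]
        _ = _ := by ring
    · exact (((tendsto_const_nhds.mul (F1 z.1)).mul (G1 z.2)).mul (K1 (z.1 + z.2))).mul
        tendsto_const_nhds
  have hlim2 : Tendsto (fun n => M * (NF n * NG n * NK n)) atTop
      (𝓝 (M * (eLpNorm f (ENNReal.ofReal p) volume *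
        eLpNorm g (ENNReal.ofReal q) volume * eLpNorm h (ENNReal.ofReal r) volume))) := by
    have nf := hf.2.ne
    have ng := hg.2.ne
    have nh := hh.2.ne
    exact ENNReal.Tendsto.const_mul (ENNReal.Tendsto.mul
      (ENNReal.Tendsto.mul F5 (Or.inr ng) G5 (Or.inr nf))
      (Or.inr nh) K5 (Or.inr (ENNReal.mul_ne_top nf ng))) (Or.inr hM)
  refine le_of_tendsto_of_tendsto' hlim.enorm hlim2 fun n => ?_
  refine (H _ _ _ (F4 n) (G4 n) (K4 n)).trans ?_
  have := F3 n
  have := G3 n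
  have := K3 n
  gcongr

/-! ### Reduction to a compactly supported smooth phase. -/

/-- By Carathéodory, three points of `s` suffice in the plane, so the hull is a continuous image of
s³ × [0,1]². -/
theorem isCompact_convexHull_plane {s : Set (ℝ × ℝ)} (hs : IsCompact s) :
    IsCompact (convexHull ℝ s) := by
  set Φ : ((ℝ × ℝ) × (ℝ × ℝ) × (ℝ × ℝ)) × ℝ × ℝ → ℝ × ℝ := fun w =>
    (1 - w.2.1) • w.1.1 + w.2.1 • ((1 - w.2.2) • w.1.2.1 + w.2.2 • w.1.2.2) with hΦ
  have hΦc : Continuous Φ := by fun_prop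
  have hI : IsCompact (Set.Icc (0 : ℝ) 1) := isCompact_Icc
  have himg : convexHull ℝ s = Φ '' ((s ×ˢ s ×ˢ s) ×ˢ Set.Icc 0 1 ×ˢ Set.Icc 0 1) := by
    refine Set.Subset.antisymm (fun x hx => ?_) ?_
    · rw [convexHull_eq_union] at hx
      simp only [Set.mem_iUnion] at hx
      obtain ⟨t, hts, hind, hxt⟩ := hx
      have hcard : t.card ≤ 3 := by
        have := hind.card_le_finrank_succ
        have h2 := Submodule.finrank_le (vectorSpan ℝ (Set.range ((↑) : t → ℝ × ℝ)))
        rw [Fintype.card_coe] at this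
        simp only [Module.finrank_prod, Module.finrank_self] at h2
        omega
      have hne : t.Nonempty := by
        rw [Finset.nonempty_iff_ne_empty]
        rintro rfl
        simp at hxt
      -- When fewer than three points are needed, one of them is repeated.
      obtain ⟨a, b, c, ha, hb, hc, hsub⟩ : ∃ a b c, a ∈ t ∧ b ∈ t ∧ c ∈ t ∧
          (t : Set (ℝ × ℝ)) ⊆ {a, b, c} := by
        have hpos := hne.card_pos
        have h123 : t.card = 1 ∨ t.card = 2 ∨ t.card = 3 := by omega
        rcases h123 with h | h | h
        · obtain ⟨a, rfl⟩ := Finset.card_eq_one.1 h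
          exact ⟨a, a, a, by simp⟩
        · obtain ⟨a, b, -, rfl⟩ := Finset.card_eq_two.1 h
          exact ⟨a, b, b, by simp⟩
        · obtain ⟨a, b, c, -, -, -, rfl⟩ := Finset.card_eq_three.1 h
          exact ⟨a, b, c, by simp⟩
      have hx3 := convexHull_mono hsub hxt
      rw [convexHull_insert (by simp), convexHull_pair, mem_convexJoin] at hx3
      obtain ⟨a', ha', y, hy, hxy⟩ := hx3
      rw [Set.mem_singleton_iff] at ha'
      subst ha'
      rw [segment_eq_image] at hy hxy
      obtain ⟨v, hv, rfl⟩ := hy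
      obtain ⟨u, hu, rfl⟩ := hxy
      exact ⟨((a', b, c), u, v), ⟨⟨hts ha, hts hb, hts hc⟩, hu, hv⟩, rfl⟩
    · rintro _ ⟨⟨⟨a, b, c⟩, u, v⟩, ⟨⟨ha, hb, hc⟩, hu, hv⟩, rfl⟩
      have hconv := convex_convexHull ℝ s
      have h := subset_convexHull ℝ s
      exact hconv (h ha) (hconv (h hb) (h hc) (by linarith [hv.2]) hv.1 (by ring))
        (by linarith [hu.2]) hu.1 (by ring)
  rw [himg]
  exact ((hs.prod (hs.prod hs)).prod (hI.prod hI)).image hΦc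

/-- Multiplication by a cutoff equal to 1 near `K`. Agreement on an open set around `K`, rather than
on `K`, makes the derivatives agree there too; analyticity enters only through smoothness. -/
theorem exists_smooth_extension {U K : Set (ℝ × ℝ)} (hU : IsOpen U) (hK : IsCompact K)
    (hKU : K ⊆ U) {S : ℝ × ℝ → ℝ} (hS : AnalyticOnNhd ℝ S U) :
    ∃ T : ℝ × ℝ → ℝ, ContDiff ℝ ∞ T ∧ HasCompactSupport T ∧
      ∃ W, IsOpen W ∧ K ⊆ W ∧ Set.EqOn T S W := by
  obtain ⟨K₁, hK₁, hKK₁, hK₁U⟩ := exists_compact_between hK hU hKU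
  obtain ⟨χ, hχ1, hχ0, -⟩ := exists_contMDiffMap_one_nhds_of_subset_interior
    (n := (⊤ : ℕ∞)) (modelWithCornersSelf ℝ (ℝ × ℝ)) hK.isClosed hKK₁
  have hχ : ContDiff ℝ ∞ χ := χ.contMDiff.contDiff
  have hsupp : Function.support (fun z => χ z * S z) ⊆ K₁ := fun z hz => by
    by_contra hc
    exact hz (by simp [hχ0 z hc])
  have htsupp : tsupport (fun z => χ z * S z) ⊆ K₁ := closure_minimal hsupp hK₁.isClosed
  refine ⟨fun z => χ z * S z, ?_, hK₁.of_isClosed_subset (isClosed_tsupport _) htsupp, ?_⟩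
  · rw [contDiff_iff_contDiffAt]
    intro z
    by_cases hz : z ∈ U
    · exact hχ.contDiffAt.mul (hS z hz).contDiffAt
    · have : z ∉ tsupport (fun z => χ z * S z) := fun h => hz (hK₁U (htsupp h))
      exact contDiffAt_const.congr_of_eventuallyEq (notMem_tsupport_iff_eventuallyEq.1 this)
  · obtain ⟨W, hW, hKW, hWχ⟩ := eventually_nhdsSet_iff_exists.1 hχ1
    exact ⟨W, hW, hKW, fun z hz => by simp [hWχ z hz]⟩

theorem partialX_eqOn {F G : ℝ × ℝ → ℝ} {W : Set (ℝ × ℝ)} (hW : IsOpen W) (h : Set.EqOn F G W) :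
    Set.EqOn (partialX F) (partialX G) W := by
  intro z hz
  have hc : ContinuousAt (fun t : ℝ => (t, z.2)) z.1 := by fun_prop
  have : ∀ᶠ t in 𝓝 z.1, (t, z.2) ∈ W := hc.eventually_mem (hW.mem_nhds hz)
  exact EventuallyEq.deriv_eq (this.mono fun t ht => h ht)

theorem partialY_eqOn {F G : ℝ × ℝ → ℝ} {W : Set (ℝ × ℝ)} (hW : IsOpen W) (h : Set.EqOn F G W) :
    Set.EqOn (partialY F) (partialY G) W := by
  intro z hz
  have hc : ContinuousAt (fun t : ℝ => (z.1, t)) z.2 := by fun_prop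
  have : ∀ᶠ t in 𝓝 z.2, (z.1, t) ∈ W := hc.eventually_mem (hW.mem_nhds hz)
  exact EventuallyEq.deriv_eq (this.mono fun t ht => h ht)

theorem opD_eqOn {F G : ℝ × ℝ → ℝ} {W : Set (ℝ × ℝ)} (hW : IsOpen W) (h : Set.EqOn F G W) :
    Set.EqOn (opD F) (opD G) W :=
  partialX_eqOn hW (partialY_eqOn hW fun z hz => by
    simp only [partialX_eqOn hW h hz, partialY_eqOn hW h hz])

theorem integrand_congr_phase {S T : ℝ × ℝ → ℝ} {φ : ℝ × ℝ → ℂ}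
    (h : ∀ z ∈ tsupport φ, T z = S z) (lam : ℝ) (f g k : ℝ → ℂ) :
    integrand lam T φ f g k = integrand lam S φ f g k := by
  funext z
  by_cases hz : z ∈ tsupport φ
  · simp only [integrand, h z hz]
  · simp only [integrand, image_eq_zero_of_notMem_tsupport hz, mul_zero]

/-! ### Conclusion. -/

theorem Admissible.exists_integrable_and_norm_form_le {S : ℝ × ℝ → ℝ} {φ : ℝ × ℝ → ℂ}
    (hA : Admissible S φ) {p q r : ℝ} (he : (p, q, r) ∈ exponents) :
    ∃ C : ℝ, 0 < C ∧ ∀ lam : ℝ, lam ≠ 0 → ∀ f g h : ℝ → ℂ,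
      MemLp f (ENNReal.ofReal p) volume → MemLp g (ENNReal.ofReal q) volume →
      MemLp h (ENNReal.ofReal r) volume →
      Integrable (integrand lam S φ f g h) volume ∧
      ‖form lam S φ f g h‖ ≤
        C * |lam| ^ (-(1 / 4) : ℝ) * normLp p f * normLp q g * normLp r h := by
  obtain ⟨C, hC, hb⟩ := hA.exists_enorm_form_le he
  obtain ⟨⟨hp, -⟩, ⟨hq, -⟩, ⟨hr, -⟩, -⟩ := he
  refine ⟨C, hC, fun lam hlam f g h hf hg hh => ?_⟩
  have hS := hA.phase_smooth.continuous
  have hφ := hA.amplitude_smooth.continuous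
  have hφc := hA.amplitude_compact
  -- The preceding estimates need measurable functions, so each function is replaced by a measurable
  -- representative.
  have ef := hf.1.ae_eq_mk
  have eg := hg.1.ae_eq_mk
  have eh := hh.1.ae_eq_mk
  have fm := hf.1.measurable_mk
  have gm := hg.1.measurable_mk
  have hm := hh.1.measurable_mk
  have hf' := (memLp_congr_ae ef).1 hf
  have hg' := (memLp_congr_ae eg).1 hg
  have hh' := (memLp_congr_ae eh).1 hh
  have hae := integrand_congr_ae lam S φ ef eg eh
  refine ⟨(integrable_congr hae).2
    (integrable_integrand hS hφ hφc lam hp hq hr fm gm hm hf' hg' hh'), ?_⟩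
  have key := enorm_form_le_of_simpleFunc hS hφ hφc lam hp hq hr ENNReal.ofReal_ne_top
    (hb lam hlam) fm gm hm hf' hg' hh'
  rw [form, ← integral_congr_ae hae, ← eLpNorm_congr_ae ef, ← eLpNorm_congr_ae eg,
    ← eLpNorm_congr_ae eh] at key
  have := ENNReal.toReal_mono (ENNReal.mul_ne_top ENNReal.ofReal_ne_top
    (ENNReal.mul_ne_top (ENNReal.mul_ne_top hf.2.ne hg.2.ne) hh.2.ne)) key
  rw [toReal_enorm, ENNReal.toReal_mul, ENNReal.toReal_mul, ENNReal.toReal_mul,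
    ENNReal.toReal_ofReal (by positivity)] at this
  simpa only [form, normLp, mul_assoc] using this

end TrilinearForm

theorem theorem1p1
    (U : Set (ℝ × ℝ)) (hU : IsOpen U) (h0 : (0 : ℝ × ℝ) ∈ U)
    (S : ℝ × ℝ → ℝ) (hS : AnalyticOnNhd ℝ S U)
    (φ : ℝ × ℝ → ℂ) (hφ : ContDiff ℝ ∞ φ) (hφc : HasCompactSupport φ)
    (hφU : convexHull ℝ (tsupport φ) ⊆ U)
    (hD : ∀ z ∈ convexHull ℝ (tsupport φ), 1 ≤ |TrilinearForm.opD S z|)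
    (p q r : ℝ) (hpqr : (p, q, r) ∈ TrilinearForm.exponents) :
    ∃ C : ℝ, 0 < C ∧ ∀ lam : ℝ, lam ≠ 0 → ∀ f g h : ℝ → ℂ,
      MemLp f (ENNReal.ofReal p) volume →
      MemLp g (ENNReal.ofReal q) volume →
      MemLp h (ENNReal.ofReal r) volume →
      Integrable (TrilinearForm.integrand lam S φ f g h) volume ∧
      ‖TrilinearForm.form lam S φ f g h‖ ≤
        C * |lam| ^ (-(1 / 4) : ℝ) * TrilinearForm.normLp p f *
          TrilinearForm.normLp q g * TrilinearForm.normLp r h := by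
  obtain ⟨T, hT, hTc, W, hW, hKW, hTS⟩ := TrilinearForm.exists_smooth_extension hU
    (TrilinearForm.isCompact_convexHull_plane hφc) hφU hS
  have hA : TrilinearForm.Admissible T φ := ⟨hT, hTc, hφ, hφc, fun z hz => by
    rw [TrilinearForm.opD_eqOn hW hTS (hKW hz)]
    exact hD z hz⟩
  obtain ⟨C, hC, hb⟩ := hA.exists_integrable_and_norm_form_le hpqr
  refine ⟨C, hC, fun lam hlam f g h hf hg hh => ?_⟩
  have e := TrilinearForm.integrand_congr_phase (φ := φ)
    (fun z hz => hTS (hKW (subset_convexHull ℝ _ hz))) lam f g h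
  have key := hb lam hlam f g h hf hg hh
  rw [TrilinearForm.form, e] at key
  exact key
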